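/- Let $t\ge 3$ be an odd integer and let $d\ge 2t-1$. Consider a finite classical polar space of rank $d$ over the field $\mathbb F_q$, i.e. the totally isotropic (for a quadric: totally singular) subspaces of a nondegenerate quadratic, Hermitian or alternating form on a finite-dimensional $\mathbb F_q$-vector space. Its type is one of $Q^+(2d-1,q)$, $H(2d-1,q)$, $Q(2d,q)$, $W(2d-1,q)$, $H(2d,q)$, $Q^-(2d+1,q)$, and accordingly put $\epsilon=0,\tfrac12,1,1,\tfrac32,2$. All dimensions are vector space dimensions. Generators are the maximal totally isotropic subspaces; they have dimension $d$. A $(d,t)$-EKR set is a set $Y$ of generators with $d-\dim(y_1\cap y_2)\le t$ for all $y_1,y_2\in Y$; it is maximal if it is not a proper subset of another $(d,t)$-EKR set. Let - $\genfrac{[}{]}{0pt}{}{n}{k}=\prod_{i=1}^{k}\frac{q^{n-i+1}-1}{q^i-1}$ for $0\le k\le n$, and $0$ otherwise; - $c_{r,t}$ be the maximum size of an $(r,t)$-EKR set of generators of a polar space of rank $r$ of the same type over $\mathbb F_q$; - $\omega(d,r)$ be the number of generators of the polar space that contain a fixed totally isotropic $(d-r)$-space (this does not depend on the choice of that space); -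 $\psi_2(n,r,s,u)$ be the number of $r$-dimensional subspaces of $\mathbb F_q^n$ meeting a fixed $s$-dimensional subspace in a subspace of dimension $u$ (and $0$ unless $0\le s\le n$); - $\psi_3(n,x,y,z,z_1,z_2)$ be the number of $z$-dimensional subspaces of $\mathbb F_q^n$ meeting a fixed $x$-dimensional subspace $X$ in dimension $z_2$ and a fixed $y$-dimensional subspace of $X$ in dimension $z_1$ (and $0$ unless $0\le y\le x\le n$); - $\psi^{\mathrm{odd}}=\sum_{i=1}^{(t-3)/2}\psi_3\bigl(d-1,\ d-\tfrac{3t-1}{2},\ d-2t+2,\ d-\tfrac{t+1}{2},\ d-\tfrac{5t-5}{2}+i,\ d-2t+1\bigr)$; - $\overline{\psi}^{\mathrm{odd}}=\psi_2\bigl(d,\ d-\tfrac{t-1}{2},\ d-\tfrac{3t-1}{2},\ d-2t+1\bigr)$; - $b_1=\genfrac{[}{]}{0pt}{}{d-\frac{3t-1}{2}}{\frac{t-3}{2}}\,c_{2t-2,t}$, $\quad b_2=\omega\bigl(d,\tfrac{t+1}{2}\bigr)\,\psi^{\mathrm{odd}}$, $\quad b_3=q^{\frac{t-1}{2}\epsilon+\binom{(t-1)/2}{2}}\,\overline{\psi}^{\mathrm{odd}}$.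 If $Y$ is a maximal $(d,t)$-EKR set with $|Y|>2b_1+b_2+b_3$, then there is a totally isotropic subspace $U$ of dimension $d-1$ such that $Y$ is the set of all generators $G$ with $\dim(G\cap U)\ge d-\frac{t+1}{2}$. -/

import Mathlib

open Module

noncomputable section

namespace ClassicalPolar

/-- The forms defining finite classical polar spaces: a nondegenerate quadratic form, a
nondegenerate Hermitian form (with respect to an involutory automorphism `σ ≠ id` of the field),
or a nondegenerate alternating form. -/
inductive PolarForm (F V : Type*) [Field F] [AddCommGroup V] [Module F V]
  | quadratic (Q : QuadraticForm F V) (nondeg : Q.Nondegenerate)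
  | hermitian (σ : F →+* F) (invol : Function.Involutive σ) (ne_id : σ ≠ RingHom.id F)
      (B : V →ₛₗ[σ] V →ₗ[F] F) (symm : B.IsSymm) (nondeg : B.Nondegenerate)
  | symplectic (B : V →ₗ[F] V →ₗ[F] F) (alt : B.IsAlt) (nondeg : B.Nondegenerate)

/-- The six types of finite classical polar spaces:
`Q⁺(2d-1,q)`, `Q(2d,q)`, `Q⁻(2d+1,q)`, `H(2d-1,q)`, `H(2d,q)`, `W(2d-1,q)`. -/
inductive PolarType
  | hyperbolic
  | parabolic
  | elliptic
  | hermitianOdd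
  | hermitianEven
  | symplectic

namespace PolarType

/-- The parameter `ε` of a type. -/
def eps : PolarType → ℝ
  | hyperbolic => 0
  | parabolic => 1
  | elliptic => 2
  | hermitianOdd => 1 / 2
  | hermitianEven => 3 / 2
  | symplectic => 1

/-- The vector space dimension of the ambient space of the polar space of given type and
rank `d` (the type's usual name records the projective dimension, which is one less). -/
def ambientDim : PolarType → ℕ → ℕ
  | hyperbolic, d => 2 * d
  | parabolic, d => 2 * d + 1
  | elliptic, d => 2 * d + 2
  | hermitianOdd, d => 2 * d
  | hermitianEven, d => 2 * d + 1
  | symplectic, d => 2 * d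

end PolarType

namespace PolarForm

variable {F V : Type*} [Field F] [AddCommGroup V] [Module F V]

/-- Totally isotropic subspaces (totally singular ones, for a quadratic form): the elements of
the polar space. -/
def IsTotallyIsotropic : PolarForm F V → Submodule F V → Prop
  | quadratic Q _, W => ∀ v ∈ W, Q v = 0
  | hermitian _ _ _ B _ _, W => ∀ v ∈ W, ∀ w ∈ W, B v w = 0
  | symplectic B _ _, W => ∀ v ∈ W, ∀ w ∈ W, B v w = 0

/-- A generator is a maximal totally isotropic subspace. -/
def IsGenerator (P : PolarForm F V) (G : Submodule F V) : Prop :=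
  Maximal P.IsTotallyIsotropic G

/-- The rank is `d` if the generators, which all have the same dimension, have dimension `d`. -/
def HasRank (P : PolarForm F V) (d : ℕ) : Prop :=
  ∃ G, P.IsGenerator G ∧ finrank F G = d

/-- The kind of form belonging to each of the six types. -/
def HasKind : PolarForm F V → PolarType → Prop
  | quadratic _ _, .hyperbolic => True
  | quadratic _ _, .parabolic => True
  | quadratic _ _, .elliptic => True
  | hermitian _ _ _ _ _ _, .hermitianOdd => True
  | hermitian _ _ _ _ _ _, .hermitianEven => True
  | symplectic _ _ _, .symplectic => True
  | _, _ => False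

/-- The form defines a polar space of type `τ` and rank `d`. -/
def IsPolarSpace (P : PolarForm F V) (τ : PolarType) (d : ℕ) : Prop :=
  P.HasKind τ ∧ finrank F V = τ.ambientDim d ∧ P.HasRank d

/-- `(d,t)`-EKR sets: sets of generators of a polar space of rank `d` that pairwise meet in
codimension at most `t`. -/
def IsEKR (P : PolarForm F V) (d t : ℕ) (Y : Set (Submodule F V)) : Prop :=
  (∀ y ∈ Y, P.IsGenerator y) ∧
    ∀ y₁ ∈ Y, ∀ y₂ ∈ Y, (d : ℤ) - finrank F ↥(y₁ ⊓ y₂) ≤ t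

/-- `(d,t)`-EKR sets that are not properly contained in another one. -/
def IsMaximalEKR (P : PolarForm F V) (d t : ℕ) (Y : Set (Submodule F V)) : Prop :=
  Maximal (P.IsEKR d t) Y

/-- `ω(d,r)`: the number of generators of the polar space `P` of rank `d` that contain a fixed
totally isotropic `(d-r)`-space `W`. This number does not depend on `W`; it is written here as the
greatest such number (and it is `0` if there is no such `W`). -/
def omega (P : PolarForm F V) (d r : ℕ) : ℕ :=
  sSup {n : ℕ | ∃ W : Submodule F V, P.IsTotallyIsotropic W ∧ (finrank F W : ℤ) = (d : ℤ) - r ∧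
    n = {G : Submodule F V | P.IsGenerator G ∧ W ≤ G}.ncard}

end PolarForm

/-- `c_{r,t}`: the maximum size of an `(r,t)`-EKR set of generators of a polar space of type `τ`
and rank `r` over `F`. -/
def maxEKR (F : Type*) [Field F] (τ : PolarType) (r t : ℕ) : ℕ :=
  sSup {n : ℕ | ∃ (P : PolarForm F (Fin (τ.ambientDim r) → F))
    (Y : Set (Submodule F (Fin (τ.ambientDim r) → F))),
    P.IsPolarSpace τ r ∧ P.IsEKR r t Y ∧ n = Y.ncard}

/-- The Gaussian coefficient. -/
def gauss (q n k : ℕ) : ℝ :=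
  if k ≤ n then ∏ i ∈ Finset.Icc 1 k, ((q : ℝ) ^ (n - i + 1) - 1) / ((q : ℝ) ^ i - 1) else 0

/-- The subspace of `F^n` of the vectors all of whose coordinates with index at least `k` vanish;
for `0 ≤ k ≤ n` this is a `k`-space. It serves as "a fixed `k`-space". -/
def coordSpace (F : Type*) [Field F] (n : ℕ) (k : ℤ) : Submodule F (Fin n → F) where
  carrier := {v | ∀ i : Fin n, k ≤ (i : ℕ) → v i = 0}
  zero_mem' := fun _ _ => rfl
  add_mem' := fun {a b} ha hb i hi => by simp [ha i hi, hb i hi]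
  smul_mem' := fun c v hv i hi => by simp [hv i hi]

/-- `ψ₂(d,r,s,u)`: the number of `r`-spaces in `F^d` meeting a fixed `s`-space in some `u`-space,
and `0` unless `0 ≤ s ≤ d`. -/
def psi2 (F : Type*) [Field F] (d : ℕ) (r s u : ℤ) : ℕ :=
  if 0 ≤ s ∧ s ≤ d then
    {Z : Submodule F (Fin d → F) | (finrank F Z : ℤ) = r ∧
      (finrank F ↥(Z ⊓ coordSpace F d s) : ℤ) = u}.ncard
  else 0

/-- `ψ₃(d,x,y,z,z₁,z₂)`: the number of `z`-spaces in `F^d` that meet a fixed `x`-space `X` in some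
`z₂`-space and a fixed `y`-space `Y ⊆ X` in some `z₁`-space, and `0` unless `0 ≤ y ≤ x ≤ d`. -/
def psi3 (F : Type*) [Field F] (d : ℕ) (x y z z₁ z₂ : ℤ) : ℕ :=
  if 0 ≤ y ∧ y ≤ x ∧ x ≤ d then
    {Z : Submodule F (Fin d → F) | (finrank F Z : ℤ) = z ∧
      (finrank F ↥(Z ⊓ coordSpace F d x) : ℤ) = z₂ ∧
      (finrank F ↥(Z ⊓ coordSpace F d y) : ℤ) = z₁}.ncard
  else 0

/-- `ψ^odd`, for odd `t` (all divisions are exact). -/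
def psiOdd (F : Type*) [Field F] (d t : ℕ) : ℕ :=
  ∑ i ∈ Finset.Icc 1 ((t - 3) / 2),
    psi3 F (d - 1) ((d : ℤ) - (3 * t - 1) / 2) ((d : ℤ) - 2 * t + 2) ((d : ℤ) - (t + 1) / 2)
      ((d : ℤ) - (5 * t - 5) / 2 + i) ((d : ℤ) - 2 * t + 1)

/-- The number written `ψ^odd` with a bar, for odd `t` (all divisions are exact). -/
def psiBarOdd (F : Type*) [Field F] (d t : ℕ) : ℕ :=
  psi2 F d ((d : ℤ) - (t - 1) / 2) ((d : ℤ) - (3 * t - 1) / 2) ((d : ℤ) - 2 * t + 1)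

/-- `b₁^odd`, for odd `t ≥ 3` and `d ≥ 2t - 1`. -/
def b1Odd (F : Type*) [Field F] (τ : PolarType) (d t : ℕ) : ℝ :=
  gauss (Nat.card F) (d - (3 * t - 1) / 2) ((t - 3) / 2) * maxEKR F τ (2 * t - 2) t

/-- `b₂^odd`, for odd `t ≥ 3` and `d ≥ 2t - 1`. -/
def b2Odd {F V : Type*} [Field F] [AddCommGroup V] [Module F V] (P : PolarForm F V)
    (d t : ℕ) : ℝ :=
  P.omega d ((t + 1) / 2) * psiOdd F d t

/-- `b₃^odd`, for odd `t ≥ 3` and `d ≥ 2t - 1`. -/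
def b3Odd (F : Type*) [Field F] (τ : PolarType) (d t : ℕ) : ℝ :=
  (Nat.card F : ℝ) ^ (((t : ℝ) - 1) / 2 * τ.eps + (((t - 1) / 2).choose 2 : ℕ)) * psiBarOdd F d t

end ClassicalPolar

end

/-!
Write `t = 2m+1` and `d = 4m+1+e`, so that two members of `Y` meet in dimension at least `e+2m`.

*Triples.* The pairwise intersections of three generators are mutually orthogonal, so their sum is
totally isotropic and has dimension at most `d` (`finrank_pairs_le`). Hence three members of `Y`
meet in dimension at least `e+m`, and if they meet in a subspace `S` of dimension exactly `e+m`,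
the sum of their pairwise intersections has dimension `d-1` or `d`.

*Finding `U`.* By maximality some two members meet in dimension exactly `e+2m`
(`exists_pair_of_maximal`), and since `|Y| > b₁` some three meet in such an `S`. Every member meets
`S` in dimension at least `e`, and at most `b₁` of them in dimension at least `e+1`. If the sum for
`S` has dimension `d-1`, it is the subspace `U` wanted (`isApprox_triSum`). If this never happens,
the sum is a generator `W`, at most `b₃` members meet it in codimension `m` and `S` in dimension
`e`, and any further member gives a second generator `W'` such that `U = W ⊓ W'` has dimension `d-1`
(`exists_isApprox_of_forall_not`). In either case, the members meeting `S`, and likewise a second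
subspace `S'`, in dimension `e` meet `U` in dimension at least `d-(t+1)/2 = e+3m`.

*All of `Y` is near `U`.* Suppose `x ∈ Y` is not. Then `x` meets `S` (or `S'`) in an `(e+1)`-space
`T` at least. Apart from at most `2b₁` members that meet `S` or `S'` in more than the least
dimension, and at most `b₂` members that meet `T` in more than the generic dimension, every member
meets a generator that `x` and `U` determine in codimension `m` (`isGen_sup_inf_perp`); there are at
most `b₃` of these. So `|Y| ≤ 2b₁+b₂+b₃`, against the assumption (`exists_forall_inf_ge`). The
generators near `U` pairwise meet in dimension at least `e+2m`, so by maximality `Y` contains all of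
them.

*The three bounds.* For `b₁`, the members containing a fixed `(e+1)`-space form an EKR set of its
residue, a polar space of rank `4m` of the same type (`ncard_le_maxEKR`). For `b₂` and `b₃`, a
generator is counted by its intersection with `U`, respectively with a generator `R`; the number of
generators meeting `R` exactly in a given subspace of codimension `k` is at most
`q ^ (kε + k.choose 2)`, by induction on `k` (`ncard_inf_eq_le`), starting from the number `q ^ ε` of
further generators on a subspace of dimension `d-1` (`lineBound`). Quadratic, Hermitian and
alternating forms are treated together through the structure `PolarGeometry`.
-/

noncomputable section

namespace ClassicalPolar

/-! ### Polar geometries -/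

/-- The common features of quadratic, Hermitian and alternating forms that the argument uses: a
reflexive sesquilinear form together with its singular vectors. For a quadratic form the
sesquilinear form is the polar form and the singular vectors are the zeros of the quadratic form.
The condition `eq_zero_of_sing` says that the radical contains no nonzero singular vector, so the
radical may be nonzero, as it is for a quadratic form in odd dimension and characteristic two. -/
structure PolarGeometry (F V : Type*) [Field F] [AddCommGroup V] [Module F V] where
  /-- The accompanying field automorphism, of order at most two. -/
  σ : F →+* F
  invol : Function.Involutive σ
  /-- The reflexive sesquilinear form. -/
  form : V →ₛₗ[σ] V →ₗ[F] F
  refl : form.IsRefl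
  /-- The singular vectors. -/
  Sing : V → Prop
  sing_smul : ∀ (a : F) {v : V}, Sing v → Sing (a • v)
  sing_add : ∀ {v w : V}, Sing v → Sing w → form v w = 0 → Sing (v + w)
  self_orth : ∀ {v : V}, Sing v → form v v = 0
  eq_zero_of_sing : ∀ {v : V}, Sing v → (∀ w, form v w = 0) → v = 0
  /-- A line through a singular point `p` that is not orthogonal to `p` contains a second singular
  point. -/
  exists_secant : ∀ {p v : V}, Sing p → form p v ≠ 0 → ∃ a : F, Sing (v + a • p)

namespace PolarGeometry

variable {F V : Type*} [Field F] [AddCommGroup V] [Module F V] (D : PolarGeometry F V)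

/-- Totally isotropic subspaces, respectively totally singular ones for a quadratic form. -/
def IsTI (W : Submodule F V) : Prop := ∀ v ∈ W, D.Sing v ∧ ∀ w ∈ W, D.form v w = 0

/-- The subspace of the vectors orthogonal to all vectors of a given subspace. -/
def perp (W : Submodule F V) : Submodule F V where
  carrier := {v | ∀ w ∈ W, D.form w v = 0}
  zero_mem' := by simp
  add_mem' := fun ha hb w hw => by simp [ha w hw, hb w hw]
  smul_mem' := fun c v hv w hw => by simp [hv w hw]

variable {D}

lemma perp_anti {W W' : Submodule F V} (h : W ≤ W') : D.perp W' ≤ D.perp W :=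
  fun _ hv w hw => hv w (h hw)

lemma le_perp_comm {W W' : Submodule F V} : W ≤ D.perp W' ↔ W' ≤ D.perp W :=
  ⟨fun h _ hw _ hv => D.refl _ _ (h hv _ hw), fun h _ hw _ hv => D.refl _ _ (h hv _ hw)⟩

lemma perp_sup (W W' : Submodule F V) : D.perp (W ⊔ W') = D.perp W ⊓ D.perp W' := by
  refine le_antisymm (le_inf (perp_anti le_sup_left) (perp_anti le_sup_right)) ?_
  rw [le_perp_comm]
  exact sup_le (le_perp_comm.1 inf_le_left) (le_perp_comm.1 inf_le_right)

lemma mem_perp_span {p v : V} : v ∈ D.perp (F ∙ p) ↔ D.form p v = 0 := by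
  refine ⟨fun h => h p (Submodule.mem_span_singleton_self p), fun h w hw => ?_⟩
  obtain ⟨a, rfl⟩ := Submodule.mem_span_singleton.1 hw
  simp [h]

lemma IsTI.mono {W W' : Submodule F V} (h : D.IsTI W') (hle : W ≤ W') : D.IsTI W :=
  fun v hv => ⟨(h v (hle hv)).1, fun w hw => (h v (hle hv)).2 w (hle hw)⟩

lemma IsTI.le_perp {W : Submodule F V} (h : D.IsTI W) : W ≤ D.perp W :=
  fun v hv w hw => (h w hw).2 v hv

lemma IsTI.sup {W W' : Submodule F V} (h : D.IsTI W) (h' : D.IsTI W') (hp : W ≤ D.perp W') :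
    D.IsTI (W ⊔ W') := by
  have hle : W ⊔ W' ≤ D.perp (W ⊔ W') := by
    rw [perp_sup]
    exact le_inf (sup_le h.le_perp (le_perp_comm.1 hp)) (sup_le hp h'.le_perp)
  intro v hv
  refine ⟨?_, fun w hw => hle hw v hv⟩
  obtain ⟨a, ha, b, hb, rfl⟩ := Submodule.mem_sup.1 hv
  exact D.sing_add (h a ha).1 (h' b hb).1 (D.refl _ _ (hp ha b hb))

lemma isTI_span {p : V} (hp : D.Sing p) : D.IsTI (F ∙ p) := by
  intro v hv
  obtain ⟨a, rfl⟩ := Submodule.mem_span_singleton.1 hv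
  refine ⟨D.sing_smul a hp, fun w hw => ?_⟩
  obtain ⟨b, rfl⟩ := Submodule.mem_span_singleton.1 hw
  simp [D.self_orth hp]

variable [FiniteDimensional F V]

/-- A totally isotropic subspace meets the radical trivially, so its orthogonal has the expected
dimension, even for forms with a nonzero radical. -/
lemma IsTI.finrank_add_finrank_perp {W : Submodule F V} (h : D.IsTI W) :
    finrank F W + finrank F (D.perp W) = finrank F V := by
  set k := finrank F W
  let b := finBasis F W
  let φ : Fin k → Dual F V := fun i => D.form (b i : V)
  have hli : LinearIndependent F φ := by
    rw [Fintype.linearIndependent_iff]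
    intro g hg
    have hz : (∑ i, D.σ (g i) • b i) = 0 := by
      have hmem := (∑ i, D.σ (g i) • b i).2
      apply Subtype.ext
      refine D.eq_zero_of_sing (h _ hmem).1 fun w => ?_
      have : D.form ((∑ i, D.σ (g i) • b i : W) : V) = ∑ i, g i • φ i := by
        simp [φ, D.invol (g _)]
      rw [this, hg]; rfl
    intro i
    have := Fintype.linearIndependent_iff.1 b.linearIndependent _ hz i
    exact D.σ.injective (by simpa using this)
  have hperp : D.perp W = (Submodule.span F (Set.range φ)).dualCoannihilator := by
    ext v
    rw [Submodule.mem_dualCoannihilator]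
    constructor
    · intro hv f hf
      induction hf using Submodule.span_induction with
      | mem x hx => obtain ⟨i, rfl⟩ := hx; exact hv _ (b i).2
      | zero => rfl
      | add x y _ _ hx hy => simp [hx, hy]
      | smul a x _ hx => simp [hx]
    · intro hv w hw
      have : (⟨w, hw⟩ : W) = ∑ i, b.repr ⟨w, hw⟩ i • b i := (b.sum_repr _).symm
      have hw' : w = ∑ i, b.repr ⟨w, hw⟩ i • (b i : V) := by
        have := congrArg Subtype.val this
        simpa only [Submodule.coe_sum, SetLike.val_smul] using this
      rw [hw']
      simp only [map_sum, LinearMap.map_smulₛₗ, LinearMap.sum_apply, LinearMap.smul_apply]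
      refine Finset.sum_eq_zero fun i _ => ?_
      have := hv (φ i) (Submodule.subset_span ⟨i, rfl⟩)
      simp only [φ] at this
      simp [this]
  have := Subspace.finrank_add_finrank_dualCoannihilator_eq (Submodule.span F (Set.range φ))
  rw [← hperp, finrank_span_eq_card hli, Fintype.card_fin] at this
  exact this

/-- Exchange: a totally isotropic subspace of less than maximal dimension can be enlarged within
any larger one. -/
lemma IsTI.exists_gt {G H : Submodule F V} (hG : D.IsTI G) (hH : D.IsTI H)
    (hlt : finrank F G < finrank F H) : ∃ G', G < G' ∧ D.IsTI G' := by
  have hGH : D.IsTI (G ⊓ H) := hG.mono inf_le_left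
  have h1 := Submodule.finrank_sup_add_finrank_inf_eq H (D.perp G)
  have h2 : finrank F ↥(H ⊔ D.perp G) ≤ finrank F (D.perp (G ⊓ H)) :=
    Submodule.finrank_mono (sup_le (le_trans hH.le_perp (perp_anti inf_le_right))
      (perp_anti inf_le_left))
  have h3 := hG.finrank_add_finrank_perp
  have h4 := hGH.finrank_add_finrank_perp
  have : ¬ H ⊓ D.perp G ≤ G := fun hle => by
    have := Submodule.finrank_mono (le_inf hle (inf_le_left : H ⊓ D.perp G ≤ H))
    omega
  obtain ⟨v, hv, hvG⟩ := SetLike.not_le_iff_exists.1 this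
  refine ⟨G ⊔ F ∙ v, ?_, ?_⟩
  · rw [left_lt_sup]
    exact fun hle => hvG (hle (Submodule.mem_span_singleton_self v))
  · refine hG.sup (isTI_span (hH v hv.1).1) ?_
    rw [le_perp_comm, Submodule.span_singleton_le_iff_mem]
    exact hv.2

variable (D) in
/-- The generators of a polar geometry of rank `d`. -/
def IsGen (d : ℕ) (G : Submodule F V) : Prop := D.IsTI G ∧ finrank F G = d

variable (D) in
/-- The geometry has rank `d`: every totally isotropic subspace lies in one of dimension `d`, and
none is larger. -/
structure HasRank (d : ℕ) : Prop where
  le : ∀ {W : Submodule F V}, D.IsTI W → finrank F W ≤ d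
  exists_gen : ∀ {W : Submodule F V}, D.IsTI W → ∃ G, W ≤ G ∧ D.IsGen d G

lemma exists_maximal {W : Submodule F V} (hW : D.IsTI W) :
    ∃ G, W ≤ G ∧ Maximal D.IsTI G := by
  obtain ⟨n, hn⟩ : ∃ n, finrank F V - finrank F W = n := ⟨_, rfl⟩
  induction n using Nat.strong_induction_on generalizing W with
  | _ n ih =>
    by_cases hmax : Maximal D.IsTI W
    · exact ⟨W, le_rfl, hmax⟩
    · rw [not_maximal_iff hW] at hmax
      obtain ⟨W', hW', hlt⟩ := hmax
      have := Submodule.finrank_lt_finrank_of_lt hlt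
      have := Submodule.finrank_le W'
      obtain ⟨G, hG, hm⟩ := ih (finrank F V - finrank F W') (by omega) hW' rfl
      exact ⟨G, (le_of_lt hlt).trans hG, hm⟩

/-- All maximal totally isotropic subspaces have the same dimension. -/
lemma hasRank_of_maximal {G : Submodule F V} (hG : Maximal D.IsTI G) :
    D.HasRank (finrank F G) := by
  have le : ∀ {W : Submodule F V}, D.IsTI W → finrank F W ≤ finrank F G := by
    intro W hW
    by_contra! hlt
    obtain ⟨G', hlt', hG'⟩ := hG.prop.exists_gt hW hlt
    exact hlt'.not_ge (hG.le_of_ge hG' hlt'.le)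
  refine ⟨le, fun {W} hW => ?_⟩
  obtain ⟨G', hle, hG'⟩ := exists_maximal hW
  refine ⟨G', hle, hG'.prop, le_antisymm (le hG'.prop) ?_⟩
  by_contra! hlt
  obtain ⟨G₂, hlt', hG₂⟩ := hG'.prop.exists_gt hG.prop hlt
  exact hlt'.not_ge (hG'.le_of_ge hG₂ hlt'.le)

lemma HasRank.maximal_iff {d : ℕ} (hd : D.HasRank d) {G : Submodule F V} :
    Maximal D.IsTI G ↔ D.IsGen d G := by
  constructor
  · intro hG
    refine ⟨hG.prop, le_antisymm (hd.le hG.prop) ?_⟩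
    obtain ⟨G', hle, hG'⟩ := hd.exists_gen hG.prop
    rw [← hG'.2]
    exact Submodule.finrank_mono (hG.le_of_ge hG'.1 hle)
  · rintro ⟨hG, hdim⟩
    refine ⟨hG, fun W hW hle => ?_⟩
    exact (Submodule.eq_of_le_of_finrank_le hle (hdim ▸ hd.le hW)).ge

/-- A singular vector orthogonal to a generator lies in it. -/
lemma IsGen.mem_of_orth {d : ℕ} (hd : D.HasRank d) {G : Submodule F V} (hG : D.IsGen d G) {v : V}
    (hv : D.Sing v) (hp : v ∈ D.perp G) : v ∈ G := by
  have hTI : D.IsTI (G ⊔ F ∙ v) := by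
    refine hG.1.sup (isTI_span hv) ?_
    rwa [le_perp_comm, Submodule.span_singleton_le_iff_mem]
  exact ((hd.maximal_iff.2 hG).le_of_ge hTI le_sup_left)
    (Submodule.mem_sup_right (Submodule.mem_span_singleton_self v))

lemma IsGen.eq_of_le {d : ℕ} (hd : D.HasRank d) {G W : Submodule F V} (hG : D.IsGen d G)
    (hW : D.IsTI W) (hle : G ≤ W) : G = W :=
  Submodule.eq_of_le_of_finrank_le hle (hG.2 ▸ hd.le hW)

lemma IsGen.eq_of_le_gen {d : ℕ} {G W : Submodule F V} (hG : D.IsGen d G)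
    (hW : D.IsGen d W) (hle : G ≤ W) : G = W :=
  Submodule.eq_of_le_of_finrank_eq hle (hG.2.trans hW.2.symm)

/-- The vectors of `W` orthogonal to `p` form `W` or a hyperplane of it. -/
lemma finrank_le_inf_perp_span (W : Submodule F V) (p : V) :
    finrank F W ≤ finrank F ↥(W ⊓ D.perp (F ∙ p)) + 1 := by
  have h1 := Submodule.finrank_sup_add_finrank_inf_eq W (D.perp (F ∙ p))
  have h2 : D.perp (F ∙ p) = LinearMap.ker (D.form p) := by
    ext v; rw [mem_perp_span, LinearMap.mem_ker]
  have h3 := (D.form p).finrank_range_add_finrank_ker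
  have h4 : finrank F (LinearMap.range (D.form p)) ≤ 1 := by
    simpa using Submodule.finrank_le (LinearMap.range (D.form p))
  have h5 := Submodule.finrank_le (W ⊔ D.perp (F ∙ p))
  rw [← h2] at h3
  omega

omit [FiniteDimensional F V] in
lemma inf_span_eq_bot {W : Submodule F V} {p : V} (hp : p ∉ W) : W ⊓ F ∙ p = ⊥ := by
  rw [← disjoint_iff, Submodule.disjoint_span_singleton]
  exact fun h => absurd h hp

lemma finrank_sup_span {W : Submodule F V} {p : V} (hp : p ∉ W) :
    finrank F ↥(W ⊔ F ∙ p) = finrank F W + 1 := by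
  have h1 := Submodule.finrank_sup_add_finrank_inf_eq W (F ∙ p)
  have h0 : p ≠ 0 := fun h => hp (h ▸ W.zero_mem)
  rw [inf_span_eq_bot hp, finrank_bot, finrank_span_singleton h0] at h1
  omega

/-- The generator spanned by a singular vector `p` and the vectors of a generator `y` orthogonal
to `p`. -/
lemma IsGen.project {d : ℕ} (hd : D.HasRank d) {y : Submodule F V} (hy : D.IsGen d y) {p : V}
    (hp : D.Sing p) (hpy : p ∉ y) :
    D.IsGen d (y ⊓ D.perp (F ∙ p) ⊔ F ∙ p) ∧
      finrank F ↥(y ⊓ D.perp (F ∙ p)) + 1 = d := by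
  have hTI : D.IsTI (y ⊓ D.perp (F ∙ p) ⊔ F ∙ p) :=
    (hy.1.mono inf_le_left).sup (isTI_span hp) inf_le_right
  have h1 := finrank_sup_span (W := y ⊓ D.perp (F ∙ p)) (p := p) (fun h => hpy h.1)
  have h2 := finrank_le_inf_perp_span (D := D) y p
  have h3 := hd.le hTI
  have h4 := hy.2
  exact ⟨⟨hTI, by omega⟩, by omega⟩

end PolarGeometry

/-! ### Dimensions of intersections -/

section Lattice

variable {F V : Type*} [Field F] [AddCommGroup V] [Module F V]

/-- The sum of the pairwise intersections of three subspaces. -/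
def triSum (a b c : Submodule F V) : Submodule F V := a ⊓ b ⊔ a ⊓ c ⊔ b ⊓ c

lemma inf_left_le_triSum (a b c : Submodule F V) : a ⊓ b ≤ triSum a b c :=
  le_sup_left.trans le_sup_left

lemma inf_mid_le_triSum (a b c : Submodule F V) : a ⊓ c ≤ triSum a b c :=
  le_sup_right.trans le_sup_left

lemma inf_right_le_triSum (a b c : Submodule F V) : b ⊓ c ≤ triSum a b c := le_sup_right

lemma triSum_def (a b c : Submodule F V) : triSum a b c = a ⊓ b ⊔ a ⊓ c ⊔ b ⊓ c := rfl

lemma triSum_le {a b c W : Submodule F V} (h1 : a ⊓ b ≤ W) (h2 : a ⊓ c ≤ W) (h3 : b ⊓ c ≤ W) :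
    triSum a b c ≤ W := sup_le (sup_le h1 h2) h3

variable [FiniteDimensional F V]

lemma finrank_triSum (a b c : Submodule F V) :
    finrank F (triSum a b c) + 2 * finrank F ↥(a ⊓ b ⊓ c) =
      finrank F ↥(a ⊓ b) + finrank F ↥(a ⊓ c) + finrank F ↥(b ⊓ c) := by
  have h1 := Submodule.finrank_sup_add_finrank_inf_eq (a ⊓ b) (a ⊓ c)
  have h2 := Submodule.finrank_sup_add_finrank_inf_eq (a ⊓ b ⊔ a ⊓ c) (b ⊓ c)
  have e1 : a ⊓ b ⊓ (a ⊓ c) = a ⊓ b ⊓ c := by rw [← inf_inf_distrib_left, inf_assoc]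
  -- the first two summands lie in `a`, so their sum meets `b ⊓ c` in `a ⊓ b ⊓ c`
  have e2 : (a ⊓ b ⊔ a ⊓ c) ⊓ (b ⊓ c) = a ⊓ b ⊓ c := by
    apply le_antisymm
    · rw [inf_assoc]
      exact le_inf (inf_le_left.trans (sup_le inf_le_left inf_le_left)) inf_le_right
    · exact le_inf (inf_le_left.trans le_sup_left)
        (le_inf (inf_le_left.trans inf_le_right) inf_le_right)
  rw [e1] at h1
  rw [e2] at h2
  unfold triSum
  omega

lemma finrank_inf_triSum_ge (y a b c : Submodule F V) :
    finrank F ↥(y ⊓ (a ⊓ b)) + finrank F ↥(y ⊓ (a ⊓ c)) + finrank F ↥(y ⊓ (b ⊓ c)) ≤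
      finrank F ↥(y ⊓ triSum a b c) + 2 * finrank F ↥(y ⊓ (a ⊓ b ⊓ c)) := by
  have h := finrank_triSum (y ⊓ a) (y ⊓ b) (y ⊓ c)
  rw [← inf_inf_distrib_left y a b, ← inf_inf_distrib_left y a c, ← inf_inf_distrib_left y b c,
    ← inf_inf_distrib_left y (a ⊓ b) c] at h
  have hle : triSum (y ⊓ a) (y ⊓ b) (y ⊓ c) ≤ y ⊓ triSum a b c := by
    unfold triSum
    simp only [← inf_inf_distrib_left]
    refine sup_le (sup_le ?_ ?_) ?_ <;> refine inf_le_inf_left y ?_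
    exacts [inf_left_le_triSum a b c, inf_mid_le_triSum a b c, inf_right_le_triSum a b c]
  have := Submodule.finrank_mono hle
  omega

/-- Two of three pairwise intersections span a subspace of any `W` that contains them. -/
lemma finrank_inf_add_finrank_inf_le {a b z W : Submodule F V} (ha : a ⊓ z ≤ W) (hb : b ⊓ z ≤ W) :
    finrank F ↥(a ⊓ z) + finrank F ↥(b ⊓ z) ≤
      finrank F ↥(z ⊓ W) + finrank F ↥(a ⊓ b ⊓ z) := by
  have h1 := Submodule.finrank_sup_add_finrank_inf_eq (a ⊓ z) (b ⊓ z)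
  have h3 := Submodule.finrank_mono (le_inf (sup_le inf_le_right inf_le_right) (sup_le ha hb) :
    a ⊓ z ⊔ b ⊓ z ≤ z ⊓ W)
  rw [← inf_inf_distrib_right] at h1
  omega

/-- Passing from a subspace `A` to `S ≤ A`, the dimension of the intersection with `y` drops by
at most the codimension of `S` in `A`. -/
lemma finrank_inf_add_le {S A : Submodule F V} (h : S ≤ A) (y : Submodule F V) :
    finrank F ↥(y ⊓ A) + finrank F S ≤ finrank F A + finrank F ↥(y ⊓ S) := by
  have h1 := Submodule.finrank_sup_add_finrank_inf_eq (y ⊓ A) S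
  have h2 := Submodule.finrank_mono (sup_le inf_le_right h : y ⊓ A ⊔ S ≤ A)
  have e : y ⊓ A ⊓ S = y ⊓ S := by rw [inf_assoc, inf_eq_right.2 h]
  rw [e] at h1
  omega

attribute [irreducible] triSum

lemma exists_le_finrank_eq (A : Submodule F V) {k : ℕ} (hk : k ≤ finrank F A) :
    ∃ S ≤ A, finrank F S = k := by
  let b := finBasis F A
  let f : Fin k → V := fun i => b (Fin.castLE hk i)
  have hli : LinearIndependent F f :=
    (b.linearIndependent.comp _ (Fin.castLE_injective hk)).map' A.subtype A.ker_subtype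
  refine ⟨Submodule.span F (Set.range f), ?_, by simp [finrank_span_eq_card hli]⟩
  rw [Submodule.span_le]
  rintro _ ⟨i, rfl⟩
  exact (b _).2

end Lattice

namespace PolarGeometry

variable {F V : Type*} [Field F] [AddCommGroup V] [Module F V] {D : PolarGeometry F V}

lemma IsTI.triSum {a b c : Submodule F V} (ha : D.IsTI a) (hb : D.IsTI b) (hc : D.IsTI c) :
    D.IsTI (triSum a b c) := by
  have h1 : D.IsTI (a ⊓ b ⊔ a ⊓ c) := ha.mono (sup_le inf_le_left inf_le_left)
  rw [triSum_def]
  refine h1.sup (hb.mono inf_le_left) (sup_le ?_ ?_)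
  · exact inf_le_right.trans (hb.le_perp.trans (perp_anti inf_le_left))
  · exact inf_le_right.trans (hc.le_perp.trans (perp_anti inf_le_right))

variable [FiniteDimensional F V]

/-! ### Connectedness and disjoint generators -/

lemma exists_gen_finrank_inf_lt {d : ℕ} {y z : Submodule F V}
    (hy : D.IsGen d y) (hz : D.IsGen d z) (hne : y ⊓ z ≠ ⊥) :
    ∃ z', D.IsGen d z' ∧ finrank F ↥(y ⊓ z') < finrank F ↥(y ⊓ z) := by
  obtain ⟨p, hp, hp0⟩ := (Submodule.ne_bot_iff _).1 hne
  have hspz : F ∙ p ≤ z := by rw [Submodule.span_singleton_le_iff_mem]; exact hp.2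
  obtain ⟨Q, hQ⟩ := Submodule.exists_isCompl (F ∙ p)
  set H := Q ⊓ z
  have hsup : F ∙ p ⊔ H = z := by
    rw [← sup_inf_assoc_of_le Q hspz, hQ.sup_eq_top, top_inf_eq]
  have hpH : p ∉ H := fun h =>
    hp0 (Submodule.disjoint_def.1 hQ.disjoint p (Submodule.mem_span_singleton_self p) h.1)
  have hdim := finrank_sup_span hpH
  rw [sup_comm, hsup] at hdim
  have hH : D.IsTI H := hz.1.mono inf_le_right
  have h1 := hH.finrank_add_finrank_perp
  have h2 := hz.1.finrank_add_finrank_perp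
  have hnle : ¬ D.perp H ≤ D.perp z := fun h => by
    have := Submodule.finrank_mono h
    omega
  obtain ⟨w, hw, hwz⟩ := SetLike.not_le_iff_exists.1 hnle
  have hpw : D.form p w ≠ 0 := by
    intro h0
    refine hwz ?_
    rw [← hsup, perp_sup]
    exact ⟨mem_perp_span.2 h0, hw⟩
  have hps : D.Sing p := (hz.1 p hp.2).1
  have hpz : ∀ x ∈ z, D.form p x = 0 := (hz.1 p hp.2).2
  obtain ⟨a, ha⟩ := D.exists_secant hps hpw
  set v := w + a • p
  have hpv : D.form p v ≠ 0 := by simpa [v, D.self_orth hps] using hpw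
  have hvH : v ∈ D.perp H := (D.perp H).add_mem hw
    ((D.perp H).smul_mem a (perp_anti inf_le_right (hz.1.le_perp hp.2)))
  have hvH' : v ∉ H := fun h => hpv (hpz v h.2)
  refine ⟨H ⊔ F ∙ v, ⟨hH.sup (isTI_span ha) ?_, ?_⟩, ?_⟩
  · rw [le_perp_comm, Submodule.span_singleton_le_iff_mem]; exact hvH
  · rw [finrank_sup_span hvH', ← hdim, hz.2]
  · refine Submodule.finrank_lt_finrank_of_lt (lt_of_le_of_ne ?_ ?_)
    · rintro x ⟨hxy, hx⟩
      obtain ⟨h, hh, u, hu, rfl⟩ := Submodule.mem_sup.1 hx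
      obtain ⟨c, rfl⟩ := Submodule.mem_span_singleton.1 hu
      have hc : D.form p (h + c • v) = 0 := (hy.1 p hp.1).2 _ hxy
      rw [map_add, hpz h hh.2, map_smul, zero_add, smul_eq_mul, mul_eq_zero] at hc
      rcases hc with hc | hc
      · refine ⟨hxy, ?_⟩
        rw [hc, zero_smul, add_zero]
        exact hh.2
      · exact absurd hc hpv
    · intro heq
      have hpm : p ∈ H ⊔ F ∙ v := (heq.ge hp).2
      obtain ⟨h, hh, u, hu, hpu⟩ := Submodule.mem_sup.1 hpm
      obtain ⟨c, rfl⟩ := Submodule.mem_span_singleton.1 hu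
      have hc : D.form p (h + c • v) = 0 := by rw [hpu]; exact D.self_orth hps
      rw [map_add, hpz h hh.2, map_smul, zero_add, smul_eq_mul, mul_eq_zero] at hc
      rcases hc with hc | hc
      · rw [hc, zero_smul, add_zero] at hpu
        exact hpH (hpu ▸ hh)
      · exact hpv hc

lemma exists_gen_inf_eq_bot {d : ℕ} {y : Submodule F V} (hy : D.IsGen d y) :
    ∃ z, D.IsGen d z ∧ y ⊓ z = ⊥ := by
  suffices ∀ n z, D.IsGen d z → finrank F ↥(y ⊓ z) = n → ∃ z, D.IsGen d z ∧ y ⊓ z = ⊥ from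
    this _ y hy rfl
  intro n
  induction n using Nat.strong_induction_on with
  | _ n ih =>
    intro z hz hn
    by_cases hb : y ⊓ z = ⊥
    · exact ⟨z, hz, hb⟩
    · obtain ⟨z', hz', hlt⟩ := exists_gen_finrank_inf_lt hy hz hb
      exact ih _ (hn ▸ hlt) z' hz' rfl

/-- The graph on the generators in which adjacency means meeting in a hyperplane is connected. -/
lemma gen_mem_of_adj_closed {d : ℕ} (hd : D.HasRank d) {Y : Set (Submodule F V)}
    (hY : ∀ y ∈ Y, D.IsGen d y)
    (hadj : ∀ y ∈ Y, ∀ z, D.IsGen d z → d ≤ finrank F ↥(y ⊓ z) + 1 → z ∈ Y)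
    (hne : Y.Nonempty) {z : Submodule F V} (hz : D.IsGen d z) : z ∈ Y := by
  obtain ⟨y₀, hy₀⟩ := hne
  suffices ∀ n, ∀ y ∈ Y, d - finrank F ↥(y ⊓ z) = n → z ∈ Y from this _ y₀ hy₀ rfl
  intro n
  induction n using Nat.strong_induction_on with
  | _ n ih =>
    intro y hy hn
    by_cases hle : z ≤ y
    · rwa [hz.eq_of_le_gen (hY y hy) hle]
    · obtain ⟨v, hv, hvy⟩ := SetLike.not_le_iff_exists.1 hle
      obtain ⟨hg, hdim⟩ := (hY y hy).project hd (hz.1 v hv).1 hvy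
      set y' := y ⊓ D.perp (F ∙ v) ⊔ F ∙ v
      have hy' : y' ∈ Y := by
        refine hadj y hy y' hg ?_
        have := Submodule.finrank_mono
          (le_inf inf_le_left le_sup_left : y ⊓ D.perp (F ∙ v) ≤ y ⊓ y')
        omega
      have hlt : y ⊓ z < y' ⊓ z := by
        refine lt_of_le_of_ne (le_inf ?_ inf_le_right) fun heq => ?_
        · refine le_trans (le_inf inf_le_left fun x hx => ?_) le_sup_left
          exact mem_perp_span.2 ((hz.1 v hv).2 x hx.2)
        · exact hvy (heq.ge
            ⟨Submodule.mem_sup_right (Submodule.mem_span_singleton_self v), hv⟩).1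
      have hlt' := Submodule.finrank_lt_finrank_of_lt hlt
      have hle' := Submodule.finrank_mono (inf_le_right : y' ⊓ z ≤ z)
      rw [hz.2] at hle'
      exact ih _ (by omega) y' hy' rfl

/-- Some two members of a maximal EKR set meet in the least dimension allowed: otherwise the set
could be enlarged by all generators adjacent to a member, and so would contain all generators,
even disjoint ones. -/
lemma exists_pair_of_maximal {d t : ℕ} (hd : D.HasRank d) (ht : t < d)
    {Y : Set (Submodule F V)} (hY : ∀ y ∈ Y, D.IsGen d y)
    (hpair : ∀ y ∈ Y, ∀ z ∈ Y, d ≤ finrank F ↥(y ⊓ z) + t)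
    (hmax : ∀ z, D.IsGen d z → (∀ y ∈ Y, d ≤ finrank F ↥(z ⊓ y) + t) → z ∈ Y)
    (hne : Y.Nonempty) : ∃ y ∈ Y, ∃ z ∈ Y, finrank F ↥(y ⊓ z) + t = d := by
  by_contra! hcon
  have hpair' : ∀ y ∈ Y, ∀ z ∈ Y, d + 1 ≤ finrank F ↥(y ⊓ z) + t := fun y hy z hz => by
    have h1 := hpair y hy z hz
    have h2 := hcon y hy z hz
    omega
  have hall : ∀ z, D.IsGen d z → z ∈ Y := fun z hz =>
    gen_mem_of_adj_closed hd hY (fun y hy z hz hyz => hmax z hz fun x hx => by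
      have h1 := hpair' y hy x hx
      have h2 := finrank_inf_add_le (inf_le_left : y ⊓ z ≤ y) x
      have h3 := Submodule.finrank_mono
        (le_inf (inf_le_right.trans inf_le_right) inf_le_left : x ⊓ (y ⊓ z) ≤ z ⊓ x)
      have h4 := (hY y hy).2
      rw [inf_comm] at h1
      omega) hne hz
  obtain ⟨y, hy⟩ := hne
  obtain ⟨z, hz, hyz⟩ := exists_gen_inf_eq_bot (hY y hy)
  have := hpair y hy z (hall z hz)
  rw [hyz, finrank_bot] at this
  omega

end PolarGeometry

namespace PolarGeometry

/-! ### Triple intersections and the subspace `U` -/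

variable {F V : Type*} [Field F] [AddCommGroup V] [Module F V] {D : PolarGeometry F V}
variable [FiniteDimensional F V]

/-- The pairwise intersections of three generators are mutually orthogonal, so their sum is totally
isotropic; this bounds the dimensions of the pairwise intersections by that of the triple one. -/
lemma finrank_pairs_le {d : ℕ} (hd : D.HasRank d) {a b c : Submodule F V}
    (ha : D.IsGen d a) (hb : D.IsGen d b) (hc : D.IsGen d c) :
    finrank F ↥(a ⊓ b) + finrank F ↥(a ⊓ c) + finrank F ↥(b ⊓ c) ≤
      d + 2 * finrank F ↥(a ⊓ b ⊓ c) := by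
  have h1 := finrank_triSum a b c
  have h2 := hd.le (ha.1.triSum hb.1 hc.1)
  omega

variable (D) in
/-- A set of generators of a geometry of rank `4m+1+e` that meet pairwise in dimension at least
`e+2m`. With `t = 2m+1` and `e = d-(2t-1)` these are the `(d,t)`-EKR sets for odd `t` and
`d ≥ 2t-1`. -/
structure IsOddEKR (m e : ℕ) (Y : Set (Submodule F V)) : Prop where
  rank : D.HasRank (4 * m + 1 + e)
  gen : ∀ y ∈ Y, D.IsGen (4 * m + 1 + e) y
  pair : ∀ y ∈ Y, ∀ z ∈ Y, e + 2 * m ≤ finrank F ↥(y ⊓ z)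

variable (D) in
/-- The subspace `U` of codimension one in a generator approximates the family `Y` along two of its
subspaces `S` and `S'` of dimension `e+m`: all members of `Y` that meet both `S` and `S'` in the
least possible dimension `e` meet `U` in dimension at least `e+3m`. -/
structure IsApprox (m e : ℕ) (Y : Set (Submodule F V)) (U S S' : Submodule F V) : Prop where
  isTI : D.IsTI U
  finrank_eq : finrank F U = e + 4 * m
  le₁ : S ≤ U
  le₂ : S' ≤ U
  finrank₁ : finrank F S = e + m
  finrank₂ : finrank F S' = e + m
  inf₁ : ∀ y ∈ Y, e ≤ finrank F ↥(y ⊓ S)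
  inf₂ : ∀ y ∈ Y, e ≤ finrank F ↥(y ⊓ S')
  inf_ge : ∀ y ∈ Y, finrank F ↥(y ⊓ S) = e → finrank F ↥(y ⊓ S') = e →
    e + 3 * m ≤ finrank F ↥(y ⊓ U)

omit [FiniteDimensional F V] in
lemma IsApprox.symm {m e : ℕ} {Y : Set (Submodule F V)} {U S S' : Submodule F V}
    (h : D.IsApprox m e Y U S S') : D.IsApprox m e Y U S' S :=
  ⟨h.isTI, h.finrank_eq, h.le₂, h.le₁, h.finrank₂, h.finrank₁, h.inf₂, h.inf₁,
    fun y hy h1 h2 => h.inf_ge y hy h2 h1⟩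

namespace IsOddEKR

variable {m e : ℕ} {Y : Set (Submodule F V)} (h : D.IsOddEKR m e Y)
include h

lemma pairs_le {a b c : Submodule F V} (ha : a ∈ Y) (hb : b ∈ Y) (hc : c ∈ Y) :
    finrank F ↥(a ⊓ b) + finrank F ↥(a ⊓ c) + finrank F ↥(b ⊓ c) ≤
      4 * m + 1 + e + 2 * finrank F ↥(a ⊓ b ⊓ c) :=
  finrank_pairs_le h.rank (h.gen a ha) (h.gen b hb) (h.gen c hc)

lemma triple {a b c : Submodule F V} (ha : a ∈ Y) (hb : b ∈ Y) (hc : c ∈ Y) :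
    e + m ≤ finrank F ↥(a ⊓ b ⊓ c) := by
  have := h.pairs_le ha hb hc
  have := h.pair a ha b hb
  have := h.pair a ha c hc
  have := h.pair b hb c hc
  omega

lemma triple' {y a b : Submodule F V} (hy : y ∈ Y) (ha : a ∈ Y) (hb : b ∈ Y) :
    e + m ≤ finrank F ↥(y ⊓ (a ⊓ b)) := by
  rw [← inf_assoc]
  exact h.triple hy ha hb

/-- A triple intersection of least dimension inside a pairwise intersection of least dimension is
met by every member in dimension at least `e`. -/
lemma quad {y a b c : Submodule F V} (hy : y ∈ Y) (ha : a ∈ Y) (hb : b ∈ Y)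
    (hab : finrank F ↥(a ⊓ b) = e + 2 * m) (habc : finrank F ↥(a ⊓ b ⊓ c) = e + m) :
    e ≤ finrank F ↥(y ⊓ (a ⊓ b ⊓ c)) := by
  have h1 := finrank_inf_add_le (inf_le_left : a ⊓ b ⊓ c ≤ a ⊓ b) y
  have h2 := h.triple' hy ha hb
  omega

/-- If three members meet pairwise and together in the least dimensions, the sum of their pairwise
intersections has dimension `d-1` and serves as `U`. -/
lemma isApprox_triSum {a b c : Submodule F V} (ha : a ∈ Y) (hb : b ∈ Y) (hc : c ∈ Y)
    (hab : finrank F ↥(a ⊓ b) = e + 2 * m) (hac : finrank F ↥(a ⊓ c) = e + 2 * m)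
    (hbc : finrank F ↥(b ⊓ c) = e + 2 * m) (habc : finrank F ↥(a ⊓ b ⊓ c) = e + m) :
    D.IsApprox m e Y (triSum a b c) (a ⊓ b ⊓ c) (a ⊓ b ⊓ c) := by
  have hS : a ⊓ b ⊓ c ≤ triSum a b c := inf_le_left.trans (inf_left_le_triSum a b c)
  have hq : ∀ y ∈ Y, e ≤ finrank F ↥(y ⊓ (a ⊓ b ⊓ c)) := fun y hy => h.quad hy ha hb hab habc
  refine ⟨(h.gen a ha).1.triSum (h.gen b hb).1 (h.gen c hc).1, ?_, hS, hS, habc, habc, hq, hq, ?_⟩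
  · have := finrank_triSum a b c
    omega
  · intro y hy h0 _
    have := finrank_inf_triSum_ge y a b c
    have := h.triple' hy ha hb
    have := h.triple' hy ha hc
    have := h.triple' hy hb hc
    omega

/-- If no three members meet as in `isApprox_triSum`, then the three pairwise intersections of any
triple with smallest possible intersection have dimensions `e+2m`, `e+2m` and `e+2m+1`, in some
order. -/
lemma pairs_eq (hno : ∀ a ∈ Y, ∀ b ∈ Y, ∀ c ∈ Y, finrank F ↥(a ⊓ b ⊓ c) = e + m →
      ¬ (finrank F ↥(a ⊓ b) = e + 2 * m ∧ finrank F ↥(a ⊓ c) = e + 2 * m ∧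
        finrank F ↥(b ⊓ c) = e + 2 * m))
    {a b c : Submodule F V} (ha : a ∈ Y) (hb : b ∈ Y) (hc : c ∈ Y)
    (habc : finrank F ↥(a ⊓ b ⊓ c) = e + m) :
    finrank F ↥(a ⊓ b) + finrank F ↥(a ⊓ c) + finrank F ↥(b ⊓ c) = 3 * (e + 2 * m) + 1 := by
  have h0 := hno a ha b hb c hc habc
  have := h.pairs_le ha hb hc
  have := h.pair a ha b hb
  have := h.pair a ha c hc
  have := h.pair b hb c hc
  omega

/-- Let `a, b, c` be a triple with smallest possible intersection `S`, where `b ⊓ c` is the larger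
one of the pairwise intersections. A member `y` that meets `S` in dimension `e` and `b ⊓ c` in
dimension `e+m` behaves like `a`: it meets `a` in the larger and `b` and `c` in the smaller
dimension. -/
lemma pairs_of_inf_eq (hno : ∀ a ∈ Y, ∀ b ∈ Y, ∀ c ∈ Y, finrank F ↥(a ⊓ b ⊓ c) = e + m →
      ¬ (finrank F ↥(a ⊓ b) = e + 2 * m ∧ finrank F ↥(a ⊓ c) = e + 2 * m ∧
        finrank F ↥(b ⊓ c) = e + 2 * m))
    {a b c y : Submodule F V} (ha : a ∈ Y) (hb : b ∈ Y) (hc : c ∈ Y) (hy : y ∈ Y)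
    (hab : finrank F ↥(a ⊓ b) = e + 2 * m) (hac : finrank F ↥(a ⊓ c) = e + 2 * m)
    (hbc : finrank F ↥(b ⊓ c) = e + 2 * m + 1) (habc : finrank F ↥(a ⊓ b ⊓ c) = e + m)
    (hyS : finrank F ↥(y ⊓ (a ⊓ b ⊓ c)) = e) (hybc : finrank F ↥(y ⊓ (b ⊓ c)) = e + m) :
    finrank F ↥(y ⊓ (a ⊓ b)) = e + m ∧ finrank F ↥(y ⊓ (a ⊓ c)) = e + m ∧
      finrank F ↥(y ⊓ a) = e + 2 * m + 1 ∧ finrank F ↥(y ⊓ b) = e + 2 * m ∧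
      finrank F ↥(y ⊓ c) = e + 2 * m := by
  have h1 := finrank_inf_add_le (inf_le_left : a ⊓ b ⊓ c ≤ a ⊓ b) y
  have h2 := finrank_inf_add_le
    (le_inf (inf_le_left.trans inf_le_left) inf_le_right : a ⊓ b ⊓ c ≤ a ⊓ c) y
  have h3 := h.triple' hy ha hb
  have h4 := h.triple' hy ha hc
  have e1 : finrank F ↥(y ⊓ (a ⊓ b)) = e + m := by omega
  have e2 : finrank F ↥(y ⊓ (a ⊓ c)) = e + m := by omega
  have p1 := h.pairs_eq hno hy ha hb (by rwa [inf_assoc])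
  have p2 := h.pairs_eq hno hy ha hc (by rwa [inf_assoc])
  have p3 := h.pairs_eq hno hy hb hc (by rwa [inf_assoc])
  have := h.pair y hy a ha
  have := h.pair y hy b hb
  have := h.pair y hy c hc
  exact ⟨e1, e2, by omega, by omega, by omega⟩

/-- If no three members meet as in `isApprox_triSum`, two triples with smallest possible
intersection yield two generators meeting in a subspace of dimension `d-1`, which serves as `U`. -/
lemma exists_isApprox_of_forall_not
    (hno : ∀ a ∈ Y, ∀ b ∈ Y, ∀ c ∈ Y, finrank F ↥(a ⊓ b ⊓ c) = e + m →
      ¬ (finrank F ↥(a ⊓ b) = e + 2 * m ∧ finrank F ↥(a ⊓ c) = e + 2 * m ∧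
        finrank F ↥(b ⊓ c) = e + 2 * m))
    {a b c z : Submodule F V} (ha : a ∈ Y) (hb : b ∈ Y) (hc : c ∈ Y) (hz : z ∈ Y)
    (hab : finrank F ↥(a ⊓ b) = e + 2 * m) (hac : finrank F ↥(a ⊓ c) = e + 2 * m)
    (hbc : finrank F ↥(b ⊓ c) = e + 2 * m + 1) (habc : finrank F ↥(a ⊓ b ⊓ c) = e + m)
    (hzS : finrank F ↥(z ⊓ (a ⊓ b ⊓ c)) = e) (hzbc : finrank F ↥(z ⊓ (b ⊓ c)) = e + m) :
    ∃ U S S', D.IsApprox m e Y U S S' := by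
  obtain ⟨hzab, hzac, hza, hzb, hzc⟩ :=
    h.pairs_of_inf_eq hno ha hb hc hz hab hac hbc habc hzS hzbc
  have habz : finrank F ↥(a ⊓ b ⊓ z) = e + m := by rw [inf_comm, hzab]
  have haz : finrank F ↥(a ⊓ z) = e + 2 * m + 1 := by rw [inf_comm, hza]
  have hbz : finrank F ↥(b ⊓ z) = e + 2 * m := by rw [inf_comm, hzb]
  have hWTI : D.IsTI (triSum a b c) := (h.gen a ha).1.triSum (h.gen b hb).1 (h.gen c hc).1
  have hWdim : finrank F (triSum a b c) = 4 * m + 1 + e := by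
    have := finrank_triSum a b c
    rw [hab, hac, hbc, habc] at this
    clear * - this
    omega
  have hW'dim : finrank F (triSum a b z) = 4 * m + 1 + e := by
    have := finrank_triSum a b z
    rw [hab, haz, hbz, habz] at this
    clear * - this
    omega
  -- `z` meets the two generators in different dimensions
  have hzW : finrank F ↥(z ⊓ triSum a b c) ≤ e + 3 * m := by
    have := finrank_inf_add_le (inf_right_le_triSum a b c) z
    rw [hbc, hWdim, hzbc] at this
    clear * - this
    omega
  have hzW' : e + 3 * m + 1 ≤ finrank F ↥(z ⊓ triSum a b z) := by
    have := finrank_inf_add_finrank_inf_le (inf_mid_le_triSum a b z) (inf_right_le_triSum a b z)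
    rw [haz, hbz, habz] at this
    clear * - this
    omega
  obtain ⟨X, hX⟩ : ∃ X : Submodule F V, X = triSum (z ⊓ a) (z ⊓ b) (z ⊓ c) := ⟨_, rfl⟩
  have hXdim : finrank F X = e + 3 * m := by
    have := finrank_triSum (z ⊓ a) (z ⊓ b) (z ⊓ c)
    rw [← inf_inf_distrib_left z a b, ← inf_inf_distrib_left z a c, ← inf_inf_distrib_left z b c,
      ← inf_inf_distrib_left z (a ⊓ b) c, hzab, hzac, hzbc, hzS, ← hX] at this
    clear * - this
    omega
  have hXz : X ≤ z := by
    rw [hX]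
    refine triSum_le ?_ ?_ ?_ <;> exact inf_le_left.trans inf_le_left
  have hXW : X ≤ triSum a b c := by
    rw [hX]
    exact triSum_le ((inf_le_inf inf_le_right inf_le_right).trans (inf_left_le_triSum a b c))
      ((inf_le_inf inf_le_right inf_le_right).trans (inf_mid_le_triSum a b c))
      ((inf_le_inf inf_le_right inf_le_right).trans (inf_right_le_triSum a b c))
  have hXW' : X ≤ triSum a b z := by
    rw [hX]
    exact triSum_le ((inf_le_inf inf_le_right inf_le_right).trans (inf_left_le_triSum a b z))
      ((le_inf (inf_le_left.trans inf_le_right) (inf_le_left.trans inf_le_left)).trans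
        (inf_mid_le_triSum a b z))
      ((le_inf (inf_le_left.trans inf_le_right) (inf_le_left.trans inf_le_left)).trans
        (inf_right_le_triSum a b z))
  obtain ⟨U, hU⟩ : ∃ U : Submodule F V, U = triSum a b c ⊓ triSum a b z := ⟨_, rfl⟩
  have hUW : U ≤ triSum a b c := hU.trans_le inf_le_left
  have hUW' : U ≤ triSum a b z := hU.trans_le inf_le_right
  have habU : a ⊓ b ≤ U := by
    rw [hU]
    exact le_inf (inf_left_le_triSum a b c) (inf_left_le_triSum a b z)
  have hUdim : finrank F U = e + 4 * m := by
    apply le_antisymm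
    · by_contra! hcon
      have hdim : 4 * m + 1 + e ≤ finrank F U := by
        clear * - hcon
        omega
      have e1 : U = triSum a b c := Submodule.eq_of_le_of_finrank_le hUW (by rw [hWdim]; exact hdim)
      have e2 : U = triSum a b z := Submodule.eq_of_le_of_finrank_le hUW' (by rw [hW'dim]; exact hdim)
      rw [← e1, e2] at hzW
      exact Nat.not_succ_le_self _ (hzW'.trans hzW)
    · have h1 := Submodule.finrank_sup_add_finrank_inf_eq (a ⊓ b) X
      have h2 := Submodule.finrank_mono (inf_le_inf_left (a ⊓ b) hXz)
      have h3 := Submodule.finrank_mono (sup_le habU (hU.symm ▸ le_inf hXW hXW'))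
      rw [hab, hXdim] at h1
      rw [habz] at h2
      clear * - h1 h2 h3
      omega
  refine ⟨U, a ⊓ b ⊓ c, a ⊓ b ⊓ z, hWTI.mono hUW, hUdim, inf_le_left.trans habU,
    inf_le_left.trans habU, habc, habz, fun y hy => h.quad hy ha hb hab habc,
    fun y hy => h.quad hy ha hb hab habz, fun y hy hyS hyS' => ?_⟩
  by_cases hybc : finrank F ↥(y ⊓ (b ⊓ c)) = e + m
  · -- `y` and `z` are of the same kind as `a`, so they meet each other and `a` in large subspaces
    obtain ⟨hyab, -, hya, -, -⟩ :=
      h.pairs_of_inf_eq hno ha hb hc hy hab hac hbc habc hyS hybc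
    have h1 := h.pairs_le hy ha hz
    have h2 := h.pair y hy z hz
    have h3 := h.triple' hy hb hz
    have h4 := finrank_inf_triSum_ge y a b z
    have h5 := finrank_inf_add_le hUW' y
    rw [hya, haz, inf_assoc] at h1
    rw [hyab, hyS'] at h4
    rw [hUdim, hW'dim] at h5
    clear * - h1 h2 h3 h4 h5
    omega
  · have h1 := finrank_inf_triSum_ge y a b c
    have h2 := h.triple' hy ha hb
    have h3 := h.triple' hy ha hc
    have h4 := h.triple' hy hb hc
    have h5 := finrank_inf_add_le hUW y
    rw [hyS] at h1
    rw [hUdim, hWdim] at h5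
    clear * - h1 h2 h3 h4 h5 hybc
    omega

variable [Finite (Submodule F V)]

/-- A large family has an approximating subspace. -/
lemma exists_isApprox (hm : 1 ≤ m) {b₁ b₃ : ℝ} (hb₃0 : 0 ≤ b₃)
    (hb₁ : ∀ S, D.IsTI S → finrank F S = e + m →
      ({y ∈ Y | e + 1 ≤ finrank F ↥(y ⊓ S)}.ncard : ℝ) ≤ b₁)
    (hb₃ : ∀ R S, D.IsGen (4 * m + 1 + e) R → S ≤ R → finrank F S = e + m →
      ({y ∈ Y | finrank F ↥(y ⊓ R) = e + 3 * m + 1 ∧ finrank F ↥(y ⊓ S) = e}.ncard : ℝ) ≤ b₃)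
    (hcard : b₁ + b₃ < Y.ncard)
    (hpair : ∃ y ∈ Y, ∃ z ∈ Y, finrank F ↥(y ⊓ z) = e + 2 * m) :
    ∃ U S S', D.IsApprox m e Y U S S' := by
  by_cases hno : ∀ a ∈ Y, ∀ b ∈ Y, ∀ c ∈ Y, finrank F ↥(a ⊓ b ⊓ c) = e + m →
      ¬ (finrank F ↥(a ⊓ b) = e + 2 * m ∧ finrank F ↥(a ⊓ c) = e + 2 * m ∧
        finrank F ↥(b ⊓ c) = e + 2 * m)
  swap
  · push Not at hno
    obtain ⟨a, ha, b, hb, c, hc, habc, hab, hac, hbc⟩ := hno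
    exact ⟨_, _, _, h.isApprox_triSum ha hb hc hab hac hbc habc⟩
  obtain ⟨a, ha, b, hb, hab⟩ := hpair
  have htri : ∃ c ∈ Y, finrank F ↥(a ⊓ b ⊓ c) = e + m := by
    by_contra! hcon
    obtain ⟨S, hS, hSdim⟩ := exists_le_finrank_eq (a ⊓ b) (k := e + m) (by omega)
    have hall : {y ∈ Y | e + 1 ≤ finrank F ↥(y ⊓ S)} = Y := by
      refine Set.sep_eq_self_iff_mem_true.2 fun y hy => ?_
      have h1 := hcon y hy
      have h2 := h.triple ha hb hy
      have h3 := finrank_inf_add_le hS y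
      rw [inf_comm] at h1 h2
      omega
    have := hb₁ S ((h.gen a ha).1.mono (hS.trans inf_le_left)) hSdim
    rw [hall] at this
    linarith
  obtain ⟨c, hc, habc⟩ := htri
  -- relabel the triple so that the larger pairwise intersection is the last one
  obtain ⟨a, ha, b, hb, c, hc, habc, hab, hac, hbc⟩ : ∃ a ∈ Y, ∃ b ∈ Y, ∃ c ∈ Y,
      finrank F ↥(a ⊓ b ⊓ c) = e + m ∧ finrank F ↥(a ⊓ b) = e + 2 * m ∧
      finrank F ↥(a ⊓ c) = e + 2 * m ∧ finrank F ↥(b ⊓ c) = e + 2 * m + 1 := by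
    have h1 := h.pairs_eq hno ha hb hc habc
    have h2 := h.pair a ha c hc
    have h3 := h.pair b hb c hc
    by_cases hac : finrank F ↥(a ⊓ c) = e + 2 * m
    · exact ⟨a, ha, b, hb, c, hc, habc, hab, hac, by omega⟩
    · exact ⟨b, hb, a, ha, c, hc, by rwa [inf_comm b a], by rwa [inf_comm b a], by omega, by omega⟩
  have hWdim := finrank_triSum a b c
  have hWgen : D.IsGen (4 * m + 1 + e) (triSum a b c) :=
    ⟨(h.gen a ha).1.triSum (h.gen b hb).1 (h.gen c hc).1, by omega⟩
  have hSW : a ⊓ b ⊓ c ≤ triSum a b c := inf_le_left.trans (inf_left_le_triSum a b c)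
  obtain ⟨z, hz, hzS, hzbc⟩ : ∃ z ∈ Y, finrank F ↥(z ⊓ (a ⊓ b ⊓ c)) = e ∧
      finrank F ↥(z ⊓ (b ⊓ c)) = e + m := by
    by_contra! hcon
    have hcov : Y ⊆ {y ∈ Y | e + 1 ≤ finrank F ↥(y ⊓ (a ⊓ b ⊓ c))} ∪
        {y ∈ Y | finrank F ↥(y ⊓ triSum a b c) = e + 3 * m + 1 ∧ finrank F ↥(y ⊓ (a ⊓ b ⊓ c)) = e} := by
      intro y hy
      have h1 : e ≤ finrank F ↥(y ⊓ (a ⊓ b ⊓ c)) := h.quad hy ha hb hab habc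
      rcases Nat.lt_or_ge e (finrank F ↥(y ⊓ (a ⊓ b ⊓ c))) with hlt | hge
      · exact Or.inl ⟨hy, hlt⟩
      · have h0 : finrank F ↥(y ⊓ (a ⊓ b ⊓ c)) = e := le_antisymm hge h1
        have h2 := hcon y hy h0
        have h3 :=
          finrank_inf_triSum_ge y a b c
        have h4 := h.triple' hy ha hb
        have h5 := h.triple' hy ha hc
        have h6 := h.triple' hy hb hc
        have h7 := finrank_inf_add_le hSW y
        exact Or.inr ⟨hy, by omega, h0⟩
    have h1 := Set.ncard_le_ncard hcov
    have h2 := h1.trans (Set.ncard_union_le _ _)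
    have h3 := hb₁ (a ⊓ b ⊓ c) ((h.gen a ha).1.mono (inf_le_left.trans inf_le_left)) habc
    have h4 := hb₃ (triSum a b c) (a ⊓ b ⊓ c) hWgen hSW habc
    have h5 : (Y.ncard : ℝ) ≤ _ := Nat.cast_le.2 h2
    push_cast at h5
    linarith
  exact h.exists_isApprox_of_forall_not hno ha hb hc hz hab hac hbc habc hzS hzbc

end IsOddEKR

end PolarGeometry

namespace PolarGeometry

/-! ### All members of a large family meet `U` in large subspaces -/

variable {F V : Type*} [Field F] [AddCommGroup V] [Module F V] {D : PolarGeometry F V}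
variable [FiniteDimensional F V]

/-- Let `x` meet `U` in too small a subspace. A generator `y` that meets `U` as expected, meets `x`
in the least dimension allowed or more, and meets some `(e+1)`-space of `x ⊓ U` in the generic
dimension, forces the sum of the pairwise intersections of `x`, `y` and `U` to be a generator. It
contains `U`, so it is determined by `x` and `U` alone. -/
lemma isGen_sup_inf_perp {m e : ℕ} (hd : D.HasRank (4 * m + 1 + e)) {x y U T : Submodule F V}
    (hx : D.IsTI x) (hy : D.IsTI y) (hU : D.IsTI U)
    (hUdim : finrank F U = e + 4 * m) (hyU : finrank F ↥(y ⊓ U) = e + 3 * m)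
    (hT : T ≤ x ⊓ U) (hTdim : finrank F T = e + 1) (hyT : finrank F ↥(y ⊓ T) + m ≤ e + 1)
    (hxy : e + 2 * m ≤ finrank F ↥(x ⊓ y)) (hxU : finrank F ↥(x ⊓ U) < e + 3 * m) :
    D.IsGen (4 * m + 1 + e) (U ⊔ x ⊓ D.perp U) ∧
      e + 3 * m + 1 ≤ finrank F ↥(y ⊓ (U ⊔ x ⊓ D.perp U)) := by
  obtain ⟨R, hR⟩ : ∃ R : Submodule F V, R = triSum x y U := ⟨_, rfl⟩
  have hRTI : D.IsTI R := hR ▸ hx.triSum hy hU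
  have hRle := hd.le hRTI
  have hxyU : x ⊓ y ⊓ U = y ⊓ (x ⊓ U) := by rw [inf_comm x y, inf_assoc]
  have hsum := finrank_triSum x y U
  rw [← hR, hyU, hxyU] at hsum
  have hsup := Submodule.finrank_sup_add_finrank_inf_eq (x ⊓ U) (y ⊓ U)
  have hsupU : x ⊓ U ⊔ y ⊓ U ≤ U := sup_le inf_le_right inf_le_right
  have hsuple := Submodule.finrank_mono hsupU
  rw [← inf_inf_distrib_right, hxyU, hyU] at hsup
  rw [hUdim] at hsuple
  have hTle := finrank_inf_add_le hT y
  rw [hTdim] at hTle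
  obtain ⟨hxU', hxy', hRdim, hsupdim⟩ : finrank F ↥(x ⊓ U) + 1 = e + 3 * m ∧
      finrank F ↥(x ⊓ y) = e + 2 * m ∧ finrank F R = 4 * m + 1 + e ∧
      finrank F ↥(x ⊓ U ⊔ y ⊓ U) = e + 4 * m := by
    clear * - hyT hxy hxU hRle hsum hsup hsuple hTle
    omega
  have hUR : U ≤ R := by
    rw [← Submodule.eq_of_le_of_finrank_eq hsupU (hsupdim.trans hUdim.symm), hR]
    exact sup_le (inf_mid_le_triSum x y U) (inf_right_le_triSum x y U)
  have hxyR : x ⊓ y ≤ R := hR ▸ inf_left_le_triSum x y U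
  have hxyP : x ⊓ y ≤ D.perp U := hxyR.trans (hRTI.le_perp.trans (perp_anti hUR))
  have hRR : R ≤ U ⊔ x ⊓ D.perp U := by
    rw [hR]
    exact triSum_le ((le_inf inf_le_left hxyP).trans le_sup_right) (inf_le_right.trans le_sup_left)
      (inf_le_right.trans le_sup_left)
  have hTI : D.IsTI (U ⊔ x ⊓ D.perp U) :=
    hU.sup (hx.mono inf_le_left) (le_perp_comm.1 inf_le_right)
  have hRgen : D.IsGen (4 * m + 1 + e) R := ⟨hRTI, hRdim⟩
  rw [← hRgen.eq_of_le hd hTI hRR]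
  refine ⟨hRgen, ?_⟩
  have h1 := finrank_inf_add_finrank_inf_le hxyR ((inf_comm U y).trans_le
    ((hR ▸ inf_right_le_triSum x y U : y ⊓ U ≤ R)))
  have h2 : x ⊓ U ⊓ y = y ⊓ (x ⊓ U) := inf_comm _ _
  rw [hxy', inf_comm U y, hyU, h2] at h1
  clear * - h1 hsup hsupdim hxU'
  omega

namespace IsOddEKR

variable {m e : ℕ} {Y : Set (Submodule F V)} (h : D.IsOddEKR m e Y)
include h
variable [Finite (Submodule F V)]

/-- A member `x` of a large family that meets `S` in more than the least dimension still meets `U`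
as expected: otherwise the bounds `b₁` (for `S` and for `S'`), `b₂` and `b₃` cover the whole
family. -/
lemma inf_ge_of_lt_inf {b₁ b₂ b₃ : ℝ} (hb₃0 : 0 ≤ b₃)
    (hb₁ : ∀ S, D.IsTI S → finrank F S = e + m →
      ({y ∈ Y | e + 1 ≤ finrank F ↥(y ⊓ S)}.ncard : ℝ) ≤ b₁)
    (hb₂ : ∀ U S T, D.IsTI U → finrank F U = e + 4 * m → S ≤ U → finrank F S = e + m →
      T ≤ S → finrank F T = e + 1 →
      ({y ∈ Y | finrank F ↥(y ⊓ U) = e + 3 * m ∧ finrank F ↥(y ⊓ S) = e ∧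
        e + 2 ≤ finrank F ↥(y ⊓ T) + m}.ncard : ℝ) ≤ b₂)
    (hb₃ : ∀ R S, D.IsGen (4 * m + 1 + e) R → S ≤ R → finrank F S = e + m →
      ({y ∈ Y | finrank F ↥(y ⊓ R) = e + 3 * m + 1 ∧ finrank F ↥(y ⊓ S) = e}.ncard : ℝ) ≤ b₃)
    (hcard : 2 * b₁ + b₂ + b₃ < Y.ncard) {U S S' : Submodule F V}
    (hU : D.IsApprox m e Y U S S') {x : Submodule F V} (hx : x ∈ Y)
    (hxS : e + 1 ≤ finrank F ↥(x ⊓ S)) : e + 3 * m ≤ finrank F ↥(x ⊓ U) := by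
  by_contra! hxU
  obtain ⟨T, hTle, hTdim⟩ := exists_le_finrank_eq (x ⊓ S) hxS
  have hTS : T ≤ S := hTle.trans inf_le_right
  have hTU : T ≤ x ⊓ U := hTle.trans (inf_le_inf_left x hU.le₁)
  obtain ⟨R, hR⟩ : ∃ R : Submodule F V, R = U ⊔ x ⊓ D.perp U := ⟨_, rfl⟩
  have hSR : S ≤ R := hR ▸ hU.le₁.trans le_sup_left
  -- a member that none of the first three bounds covers meets the generator `R` in dimension
  -- `e+3m+1`
  have key : ∀ y ∈ Y, finrank F ↥(y ⊓ S) = e → finrank F ↥(y ⊓ S') = e →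
      ¬ (finrank F ↥(y ⊓ U) = e + 3 * m ∧ finrank F ↥(y ⊓ S) = e ∧
        e + 2 ≤ finrank F ↥(y ⊓ T) + m) →
      D.IsGen (4 * m + 1 + e) R ∧ finrank F ↥(y ⊓ R) = e + 3 * m + 1 := by
    intro y hy hyS hyS' hyT
    have hyU : finrank F ↥(y ⊓ U) = e + 3 * m := by
      have h1 := hU.inf_ge y hy hyS hyS'
      have h2 := finrank_inf_add_le hU.le₁ y
      rw [hU.finrank₁, hU.finrank_eq, hyS] at h2
      clear * - h1 h2
      omega
    have hyT' : finrank F ↥(y ⊓ T) + m ≤ e + 1 := by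
      by_contra! hcon
      exact hyT ⟨hyU, hyS, hcon⟩
    obtain ⟨hgen, hge⟩ := isGen_sup_inf_perp h.rank (h.gen x hx).1 (h.gen y hy).1 hU.isTI
      hU.finrank_eq hyU hTU hTdim hyT' (h.pair x hx y hy) hxU
    rw [← hR] at hgen hge
    refine ⟨hgen, le_antisymm ?_ hge⟩
    have h2 := finrank_inf_add_le hSR y
    rw [hU.finrank₁, hgen.2, hyS] at h2
    clear * - h2
    omega
  have hcov : Y ⊆ {y ∈ Y | e + 1 ≤ finrank F ↥(y ⊓ S)} ∪ {y ∈ Y | e + 1 ≤ finrank F ↥(y ⊓ S')} ∪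
      {y ∈ Y | finrank F ↥(y ⊓ U) = e + 3 * m ∧ finrank F ↥(y ⊓ S) = e ∧
        e + 2 ≤ finrank F ↥(y ⊓ T) + m} ∪ {y ∈ Y | D.IsGen (4 * m + 1 + e) R ∧
          finrank F ↥(y ⊓ R) = e + 3 * m + 1 ∧ finrank F ↥(y ⊓ S) = e} := by
    intro y hy
    by_cases h1 : e + 1 ≤ finrank F ↥(y ⊓ S)
    · exact Or.inl (Or.inl (Or.inl ⟨hy, h1⟩))
    by_cases h2 : e + 1 ≤ finrank F ↥(y ⊓ S')
    · exact Or.inl (Or.inl (Or.inr ⟨hy, h2⟩))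
    by_cases h3 : finrank F ↥(y ⊓ U) = e + 3 * m ∧ finrank F ↥(y ⊓ S) = e ∧
        e + 2 ≤ finrank F ↥(y ⊓ T) + m
    · exact Or.inl (Or.inr ⟨hy, h3⟩)
    have hyS : finrank F ↥(y ⊓ S) = e := le_antisymm (by omega) (hU.inf₁ y hy)
    have hyS' : finrank F ↥(y ⊓ S') = e := le_antisymm (by omega) (hU.inf₂ y hy)
    obtain ⟨h4, h5⟩ := key y hy hyS hyS' h3
    exact Or.inr ⟨hy, h4, h5, hyS⟩
  have hb₃' : ({y ∈ Y | D.IsGen (4 * m + 1 + e) R ∧ finrank F ↥(y ⊓ R) = e + 3 * m + 1 ∧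
      finrank F ↥(y ⊓ S) = e}.ncard : ℝ) ≤ b₃ := by
    by_cases hgen : D.IsGen (4 * m + 1 + e) R
    · simpa [hgen] using hb₃ R S hgen hSR hU.finrank₁
    · simpa [hgen] using hb₃0
  have h1 := (Set.ncard_le_ncard hcov).trans ((Set.ncard_union_le _ _).trans
    (Nat.add_le_add_right ((Set.ncard_union_le _ _).trans
      (Nat.add_le_add_right (Set.ncard_union_le _ _) _)) _))
  have h2 : (Y.ncard : ℝ) ≤ _ := Nat.cast_le.2 h1
  push_cast at h2
  have h3 := hb₁ S (hU.isTI.mono hU.le₁) hU.finrank₁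
  have h4 := hb₁ S' (hU.isTI.mono hU.le₂) hU.finrank₂
  have h5 := hb₂ U S T hU.isTI hU.finrank_eq hU.le₁ hU.finrank₁ hTS hTdim
  linarith

/-- A large family consists of generators that all meet some totally isotropic `(d-1)`-space in
dimension at least `d-(t+1)/2`. -/
lemma exists_forall_inf_ge (hm : 1 ≤ m) {b₁ b₂ b₃ : ℝ} (hb₁0 : 0 ≤ b₁) (hb₂0 : 0 ≤ b₂)
    (hb₃0 : 0 ≤ b₃)
    (hb₁ : ∀ S, D.IsTI S → finrank F S = e + m →
      ({y ∈ Y | e + 1 ≤ finrank F ↥(y ⊓ S)}.ncard : ℝ) ≤ b₁)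
    (hb₂ : ∀ U S T, D.IsTI U → finrank F U = e + 4 * m → S ≤ U → finrank F S = e + m →
      T ≤ S → finrank F T = e + 1 →
      ({y ∈ Y | finrank F ↥(y ⊓ U) = e + 3 * m ∧ finrank F ↥(y ⊓ S) = e ∧
        e + 2 ≤ finrank F ↥(y ⊓ T) + m}.ncard : ℝ) ≤ b₂)
    (hb₃ : ∀ R S, D.IsGen (4 * m + 1 + e) R → S ≤ R → finrank F S = e + m →
      ({y ∈ Y | finrank F ↥(y ⊓ R) = e + 3 * m + 1 ∧ finrank F ↥(y ⊓ S) = e}.ncard : ℝ) ≤ b₃)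
    (hcard : 2 * b₁ + b₂ + b₃ < Y.ncard)
    (hpair : ∃ y ∈ Y, ∃ z ∈ Y, finrank F ↥(y ⊓ z) = e + 2 * m) :
    ∃ U, D.IsTI U ∧ finrank F U = e + 4 * m ∧ ∀ y ∈ Y, e + 3 * m ≤ finrank F ↥(y ⊓ U) := by
  obtain ⟨U, S, S', hU⟩ := h.exists_isApprox hm hb₃0 hb₁ hb₃ (by linarith) hpair
  refine ⟨U, hU.isTI, hU.finrank_eq, fun y hy => ?_⟩
  by_cases h1 : e + 1 ≤ finrank F ↥(y ⊓ S)
  · exact h.inf_ge_of_lt_inf hb₃0 hb₁ hb₂ hb₃ hcard hU hy h1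
  by_cases h2 : e + 1 ≤ finrank F ↥(y ⊓ S')
  · exact h.inf_ge_of_lt_inf hb₃0 hb₁ hb₂ hb₃ hcard hU.symm hy h2
  · exact hU.inf_ge y hy (le_antisymm (by omega) (hU.inf₁ y hy))
      (le_antisymm (by omega) (hU.inf₂ y hy))

end IsOddEKR

end PolarGeometry

/-! ### Counting by fibres -/

section Count

variable {α β : Type*} [Finite α] [Finite β]

lemma ncard_le_mul_of_fiber {A : Set α} {B : Set β} (f : α → β) (hf : ∀ a ∈ A, f a ∈ B) (c : ℝ)
    (hc : ∀ b ∈ B, ({a ∈ A | f a = b}.ncard : ℝ) ≤ c) : (A.ncard : ℝ) ≤ c * B.ncard := by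
  classical
  have := Fintype.ofFinite α
  have := Fintype.ofFinite β
  have h := Finset.card_eq_sum_card_fiberwise (f := f) (s := A.toFinset) (t := B.toFinset)
    (fun a ha => by simpa using hf a (by simpa using ha))
  rw [Set.ncard_eq_toFinset_card' A, Set.ncard_eq_toFinset_card' B, h]
  push_cast
  calc _ ≤ ∑ b ∈ B.toFinset, c := Finset.sum_le_sum fun b hb => by
        refine le_trans (le_of_eq ?_) (hc b (by simpa using hb))
        rw [← Set.ncard_coe_finset]
        congr 2
        ext a
        simp
    _ = c * (B.toFinset.card : ℝ) := by rw [Finset.sum_const, nsmul_eq_mul, mul_comm]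

end Count

/-! ### Adapted families of vectors -/

section Linear

variable {F V : Type*} [Field F] [AddCommGroup V] [Module F V]

lemma finite_submodule (F V : Type*) [Field F] [Finite F] [AddCommGroup V] [Module F V]
    [FiniteDimensional F V] : Finite (Submodule F V) := by
  have : Finite V := Module.finite_of_finite F
  infer_instance

lemma finrank_map_of_injective {E : Type*} [AddCommGroup E] [Module F E] {j : E →ₗ[F] V}
    (hj : Function.Injective j) (Z : Submodule F E) : finrank F (Z.map j) = finrank F Z :=
  (Submodule.equivMapOfInjective j hj Z).finrank_eq.symm

lemma finrank_comap_of_injective {E : Type*} [AddCommGroup E] [Module F E] {j : E →ₗ[F] V}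
    (hj : Function.Injective j) (Z : Submodule F V) :
    finrank F (Z.comap j) = finrank F ↥(Z ⊓ LinearMap.range j) := by
  rw [← finrank_map_of_injective hj, Submodule.map_comap_eq, inf_comm]

variable [FiniteDimensional F V]

lemma exists_extend_linearIndependent {S : Submodule F V} {k n : ℕ} (hkn : k ≤ n)
    (hS : finrank F S = n) (w : Fin k → V) (hw : LinearIndependent F w) (hwS : ∀ i, w i ∈ S) :
    ∃ w' : Fin n → V, LinearIndependent F w' ∧ (∀ i, w' i ∈ S) ∧
      ∀ i, w' (Fin.castLE hkn i) = w i := by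
  obtain ⟨l, hl⟩ : ∃ l, n - k = l := ⟨_, rfl⟩
  induction l generalizing k with
  | zero =>
    obtain rfl : k = n := by omega
    exact ⟨w, hw, hwS, fun i => rfl⟩
  | succ l ih =>
    have hspan : Submodule.span F (Set.range w) ≤ S := by
      rw [Submodule.span_le]
      rintro _ ⟨i, rfl⟩
      exact hwS i
    have hnle : ¬ S ≤ Submodule.span F (Set.range w) := fun hle => by
      have := Submodule.finrank_mono hle
      rw [finrank_span_eq_card hw, Fintype.card_fin] at this
      omega
    obtain ⟨v, hv, hvw⟩ := SetLike.not_le_iff_exists.1 hnle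
    obtain ⟨w', h1, h2, h3⟩ := ih (k := k + 1) (by omega) (Fin.snoc w v) (hw.finSnoc hvw)
      (fun i => by
        refine Fin.lastCases ?_ (fun j => ?_) i
        · simpa using hv
        · simpa using hwS j) (by omega)
    refine ⟨w', h1, h2, fun i => ?_⟩
    have := h3 i.castSucc
    rw [Fin.snoc_castSucc] at this
    rw [← this]
    rfl

lemma span_eq_of_finrank {S : Submodule F V} {n : ℕ} (hS : finrank F S = n) {w : Fin n → V}
    (hw : LinearIndependent F w) (hwS : ∀ i, w i ∈ S) : Submodule.span F (Set.range w) = S := by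
  refine Submodule.eq_of_le_of_finrank_eq ?_ ?_
  · rw [Submodule.span_le]
    rintro _ ⟨i, rfl⟩
    exact hwS i
  · rw [finrank_span_eq_card hw, Fintype.card_fin, hS]

/-- The image of a coordinate subspace under the map sending the standard basis to `w`. -/
lemma map_coordSpace_eq {S : Submodule F V} {n a : ℕ} (han : a ≤ n) (hS : finrank F S = a)
    {w : Fin n → V} (hw : LinearIndependent F w) (hwS : ∀ i : Fin a, w (Fin.castLE han i) ∈ S) :
    (coordSpace F n a).map (Fintype.linearCombination F w) = S := by
  classical
  have hspan := span_eq_of_finrank hS (hw.comp _ (Fin.castLE_injective han)) hwS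
  apply le_antisymm
  · rintro _ ⟨v, hv, rfl⟩
    rw [Fintype.linearCombination_apply]
    refine Submodule.sum_mem _ fun i _ => ?_
    by_cases hi : (i : ℕ) < a
    · exact S.smul_mem _ (hwS ⟨i, hi⟩)
    · rw [hv i (by omega), zero_smul]
      exact S.zero_mem
  · rw [← hspan, Submodule.span_le]
    rintro _ ⟨i, rfl⟩
    refine ⟨Pi.single (Fin.castLE han i) 1, fun l hl => ?_, ?_⟩
    · rw [Pi.single_apply, if_neg]
      rintro rfl
      have := i.2
      simp at hl
      omega
    · simp [Fintype.linearCombination_apply_single]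

/-- A flag `T ≤ S ≤ U` is the image of a flag of coordinate subspaces under an injective linear
map. -/
lemma exists_injective_map_coordSpace {T S U : Submodule F V} {b a n : ℕ} (hTS : T ≤ S)
    (hSU : S ≤ U) (hT : finrank F T = b) (hS : finrank F S = a) (hU : finrank F U = n) :
    ∃ j : (Fin n → F) →ₗ[F] V, Function.Injective j ∧ LinearMap.range j = U ∧
      (coordSpace F n a).map j = S ∧ (coordSpace F n b).map j = T := by
  have hba : b ≤ a := hT ▸ hS ▸ Submodule.finrank_mono hTS
  have han : a ≤ n := hS ▸ hU ▸ Submodule.finrank_mono hSU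
  obtain ⟨w₁, h₁, h₁T, -⟩ := exists_extend_linearIndependent (Nat.zero_le b) hT Fin.elim0
    linearIndependent_empty_type (fun i => i.elim0)
  obtain ⟨w₂, h₂, h₂S, h₂e⟩ := exists_extend_linearIndependent hba hS w₁ h₁ fun i => hTS (h₁T i)
  obtain ⟨w₃, h₃, h₃U, h₃e⟩ := exists_extend_linearIndependent han hU w₂ h₂ fun i => hSU (h₂S i)
  refine ⟨Fintype.linearCombination F w₃, ?_, ?_, ?_, ?_⟩
  · exact h₃.fintypeLinearCombination_injective
  · rw [Fintype.range_linearCombination, span_eq_of_finrank hU h₃ h₃U]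
  · exact map_coordSpace_eq han hS h₃ fun i => by rw [h₃e]; exact h₂S i
  · refine map_coordSpace_eq (hba.trans han) hT h₃ fun i => ?_
    have := h₃e (Fin.castLE hba i)
    rw [h₂e] at this
    have h := h₁T i
    rw [← this] at h
    exact h

variable [Finite F]

/-- Hyperplanes of `W` that contain `Z` and avoid the point `p`. -/
lemma ncard_hyperplanes_le {W Z : Submodule F V} {p : V} {k : ℕ} (hZW : Z ≤ W) (hpW : p ∈ W)
    (hpZ : p ∉ Z) (hk : finrank F Z + 1 + k = finrank F W) :
    {K : Submodule F V | Z ≤ K ∧ K ≤ W ∧ p ∉ K ∧ finrank F K + 1 = finrank F W}.ncard ≤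
      Nat.card F ^ k := by
  obtain ⟨Q, hQ⟩ := Submodule.exists_isCompl (Z ⊔ F ∙ p)
  have hZp : Z ⊔ F ∙ p ≤ W := sup_le hZW (by rwa [Submodule.span_singleton_le_iff_mem])
  have hsup : Z ⊔ F ∙ p ⊔ Q ⊓ W = W := by
    rw [← sup_inf_assoc_of_le Q hZp, hQ.sup_eq_top, top_inf_eq]
  have hC : finrank F ↥(Q ⊓ W) = k := by
    have h1 := Submodule.finrank_sup_add_finrank_inf_eq (Z ⊔ F ∙ p) (Q ⊓ W)
    have h2 : (Z ⊔ F ∙ p) ⊓ (Q ⊓ W) = ⊥ :=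
      eq_bot_iff.2 (le_trans (inf_le_inf_left _ inf_le_left) hQ.inf_eq_bot.le)
    have h3 := PolarGeometry.finrank_sup_span hpZ
    rw [hsup, h2, finrank_bot] at h1
    omega
  obtain ⟨w, hw, hwC, -⟩ := exists_extend_linearIndependent (Nat.zero_le k) hC Fin.elim0
    linearIndependent_empty_type (fun i => i.elim0)
  have hspan := span_eq_of_finrank hC hw hwC
  let g : (Fin k → F) → Submodule F V := fun a =>
    Z ⊔ Submodule.span F (Set.range fun i => w i + a i • p)
  have hsub : {K : Submodule F V | Z ≤ K ∧ K ≤ W ∧ p ∉ K ∧ finrank F K + 1 = finrank F W} ⊆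
      Set.range g := by
    rintro K ⟨hZK, hKW, hpK, hK⟩
    have hKp : K ⊔ F ∙ p = W := by
      refine Submodule.eq_of_le_of_finrank_eq
        (sup_le hKW (by rwa [Submodule.span_singleton_le_iff_mem])) ?_
      rw [PolarGeometry.finrank_sup_span hpK, hK]
    have hex : ∀ i, ∃ a : F, w i + a • p ∈ K := by
      intro i
      have hi : w i ∈ K ⊔ F ∙ p := hKp.ge (hwC i).2
      obtain ⟨x, hx, u, hu, hxu⟩ := Submodule.mem_sup.1 hi
      obtain ⟨c, rfl⟩ := Submodule.mem_span_singleton.1 hu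
      exact ⟨-c, by rw [← hxu]; simpa using hx⟩
    choose a ha using hex
    refine ⟨a, ?_⟩
    have hle : g a ≤ K := by
      refine sup_le hZK ?_
      rw [Submodule.span_le]
      rintro _ ⟨i, rfl⟩
      exact ha i
    refine Submodule.eq_of_le_of_finrank_le hle ?_
    have hW : W ≤ g a ⊔ F ∙ p := by
      rw [← hsup]
      refine sup_le (sup_le (le_sup_left.trans le_sup_left) le_sup_right) ?_
      rw [← hspan, Submodule.span_le]
      rintro _ ⟨i, rfl⟩
      have h1 : w i + a i • p ∈ g a ⊔ F ∙ p := Submodule.mem_sup_left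
        (Submodule.mem_sup_right (Submodule.subset_span ⟨i, rfl⟩))
      have h2 : a i • p ∈ g a ⊔ F ∙ p := Submodule.mem_sup_right
        (Submodule.smul_mem _ _ (Submodule.mem_span_singleton_self p))
      simpa using Submodule.sub_mem _ h1 h2
    have h1 := Submodule.finrank_mono hW
    rw [PolarGeometry.finrank_sup_span (fun h => hpK (hle h))] at h1
    omega
  calc _ ≤ (Set.range g).ncard := Set.ncard_le_ncard hsub (Set.finite_range g)
    _ ≤ (Set.univ : Set (Fin k → F)).ncard := by
        rw [← Set.image_univ]; exact Set.ncard_image_le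
    _ = _ := by rw [Set.ncard_univ, Nat.card_fun, Nat.card_fin]

/-! ### The Gaussian coefficient bounds the number of subspaces -/

lemma ncard_finrank_eq_mul_le (k : ℕ) (hk : k ≤ finrank F V) :
    {T : Submodule F V | finrank F T = k}.ncard *
        ∏ i : Fin k, (Nat.card F ^ k - Nat.card F ^ (i : ℕ)) ≤
      ∏ i : Fin k, (Nat.card F ^ finrank F V - Nat.card F ^ (i : ℕ)) := by
  classical
  have := Fintype.ofFinite F
  have : Finite V := Module.finite_of_finite F
  have := Fintype.ofFinite {T : Submodule F V // finrank F T = k}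
  rw [Nat.card_eq_fintype_card, ← card_linearIndependent (K := F) (V := V) hk]
  have h1 : Nat.card (Σ T : {T : Submodule F V // finrank F T = k},
      {s : Fin k → T.1 // LinearIndependent F s}) = {T : Submodule F V | finrank F T = k}.ncard *
        ∏ i : Fin k, (Fintype.card F ^ k - Fintype.card F ^ (i : ℕ)) := by
    rw [Nat.card_sigma]
    have : ∀ T : {T : Submodule F V // finrank F T = k},
        Nat.card {s : Fin k → T.1 // LinearIndependent F s} =
          ∏ i : Fin k, (Fintype.card F ^ k - Fintype.card F ^ (i : ℕ)) := fun T => by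
      rw [card_linearIndependent (K := F) (V := T.1) T.2.ge, T.2]
    simp only [this, Finset.sum_const, Finset.card_univ, smul_eq_mul]
    rw [← Nat.card_eq_fintype_card, ← Nat.card_coe_set_eq]
    rfl
  rw [← h1]
  refine Nat.card_le_card_of_injective
    (fun x => ⟨fun i => (x.2.1 i : V), x.2.2.map' x.1.1.subtype x.1.1.ker_subtype⟩) ?_
  rintro ⟨⟨T, hT⟩, s, hs⟩ ⟨⟨T', hT'⟩, s', hs'⟩ heq
  have heq' : (fun i => (s i : V)) = fun i => (s' i : V) := congrArg Subtype.val heq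
  have e1 := span_eq_of_finrank hT (w := fun i => (s i : V)) (hs.map' T.subtype T.ker_subtype)
    fun i => (s i).2
  have e2 := span_eq_of_finrank hT' (w := fun i => (s' i : V))
    (hs'.map' T'.subtype T'.ker_subtype) fun i => (s' i).2
  obtain rfl : T = T' := by rw [← e1, ← e2, heq']
  obtain rfl : s = s' := funext fun i => Subtype.ext (congrFun heq' i)
  rfl

lemma gauss_eq_prod {q n k : ℕ} (hq : 1 < q) (hkn : k ≤ n) :
    gauss q n k * ∏ i : Fin k, ((q : ℝ) ^ k - (q : ℝ) ^ (i : ℕ)) =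
      ∏ i : Fin k, ((q : ℝ) ^ n - (q : ℝ) ^ (i : ℕ)) := by
  have hq' : (1 : ℝ) < q := by exact_mod_cast hq
  rw [Fin.prod_univ_eq_prod_range (fun i => (q : ℝ) ^ k - (q : ℝ) ^ i),
    Fin.prod_univ_eq_prod_range (fun i => (q : ℝ) ^ n - (q : ℝ) ^ i), gauss, if_pos hkn,
    Finset.prod_div_distrib]
  have hicc : ∀ f : ℕ → ℝ, ∏ i ∈ Finset.Icc 1 k, f i = ∏ i ∈ Finset.range k, f (i + 1) := by
    intro f
    rw [Finset.range_eq_Ico, Finset.prod_Ico_add' f 0 k 1]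
    rfl
  rw [hicc, hicc]
  have hne : ∏ i ∈ Finset.range k, ((q : ℝ) ^ (i + 1) - 1) ≠ 0 :=
    Finset.prod_ne_zero_iff.2 fun i _ => (sub_pos.2 (one_lt_pow₀ hq' (by omega))).ne'
  have hk : ∏ i ∈ Finset.range k, ((q : ℝ) ^ k - (q : ℝ) ^ i) =
      (∏ i ∈ Finset.range k, (q : ℝ) ^ i) * ∏ i ∈ Finset.range k, ((q : ℝ) ^ (i + 1) - 1) := by
    rw [← Finset.prod_range_reflect (fun i => (q : ℝ) ^ (i + 1) - 1), ← Finset.prod_mul_distrib]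
    refine Finset.prod_congr rfl fun i hi => ?_
    have hi := Finset.mem_range.1 hi
    rw [mul_sub, mul_one, ← pow_add]
    congr 2
    omega
  have hn : ∏ i ∈ Finset.range k, ((q : ℝ) ^ n - (q : ℝ) ^ i) =
      (∏ i ∈ Finset.range k, (q : ℝ) ^ i) *
        ∏ i ∈ Finset.range k, ((q : ℝ) ^ (n - (i + 1) + 1) - 1) := by
    rw [← Finset.prod_mul_distrib]
    refine Finset.prod_congr rfl fun i hi => ?_
    have hi := Finset.mem_range.1 hi
    rw [mul_sub, mul_one, ← pow_add]
    congr 2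
    omega
  rw [hk, hn]
  field_simp

lemma ncard_finrank_eq_le_gauss {k : ℕ} (hk : k ≤ finrank F V) :
    ({T : Submodule F V | finrank F T = k}.ncard : ℝ) ≤ gauss (Nat.card F) (finrank F V) k := by
  have hq : 1 < Nat.card F := Finite.one_lt_card
  have hq' : (1 : ℝ) < Nat.card F := by exact_mod_cast hq
  have hpos : 0 < ∏ i : Fin k, ((Nat.card F : ℝ) ^ k - (Nat.card F : ℝ) ^ (i : ℕ)) :=
    Finset.prod_pos fun i _ => sub_pos.2 (pow_lt_pow_right₀ hq' i.2)
  rw [← mul_le_mul_iff_left₀ hpos, gauss_eq_prod hq hk]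
  have h := ncard_finrank_eq_mul_le (F := F) (V := V) k hk
  have h' : ((({T : Submodule F V | finrank F T = k}.ncard *
        ∏ i : Fin k, (Nat.card F ^ k - Nat.card F ^ (i : ℕ)) : ℕ)) : ℝ) ≤ _ := Nat.cast_le.2 h
  push_cast at h'
  have hcast : ∀ n, k ≤ n → ∀ i : Fin k, ((Nat.card F ^ n - Nat.card F ^ (i : ℕ) : ℕ) : ℝ) =
      (Nat.card F : ℝ) ^ n - (Nat.card F : ℝ) ^ (i : ℕ) := fun n hn i => by
    rw [Nat.cast_sub (Nat.pow_le_pow_right hq.le (i.2.le.trans hn))]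
    push_cast
    rfl
  simpa only [hcast k le_rfl, hcast _ hk] using h'

/-- The number of subspaces of given codimension; by duality, this is the number of subspaces of
the complementary dimension. -/
lemma ncard_codim_eq_le_gauss {k l : ℕ} (hk : l + k = finrank F V) :
    ({T : Submodule F V | finrank F T = l}.ncard : ℝ) ≤ gauss (Nat.card F) (finrank F V) k := by
  have h := ncard_finrank_eq_le_gauss (F := F) (V := Dual F V) (k := k)
    (by rw [Subspace.dual_finrank_eq]; omega)
  rw [Subspace.dual_finrank_eq] at h
  refine le_trans (Nat.cast_le.2 ?_) h
  have := finite_submodule F (Dual F V)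
  refine Set.ncard_le_ncard_of_injOn (fun T => T.dualAnnihilator) (fun T hT => ?_)
    (fun T _ T' _ h => Subspace.dualAnnihilator_inj.1 h)
  have h1 := Subspace.finrank_add_finrank_dualAnnihilator_eq T
  have hT : finrank F T = l := hT
  show finrank F T.dualAnnihilator = k
  omega

lemma ncard_le_codim_le_gauss {S : Submodule F V} {k l n : ℕ} (hS : finrank F S = n)
    (hk : l + k = n) :
    ({T : Submodule F V | T ≤ S ∧ finrank F T = l}.ncard : ℝ) ≤ gauss (Nat.card F) n k := by
  subst hS
  refine le_trans (Nat.cast_le.2 ?_) (ncard_codim_eq_le_gauss hk)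
  have := finite_submodule F S
  refine Set.ncard_le_ncard_of_injOn (fun T => T.comap S.subtype) (fun T hT => ?_)
    (fun T hT T' hT' h => ?_)
  · show finrank F (T.comap S.subtype) = l
    rw [finrank_comap_of_injective S.injective_subtype, Submodule.range_subtype,
      inf_eq_left.2 hT.1, hT.2]
  · have h' := congrArg (Submodule.map S.subtype) h
    simp only [Submodule.map_comap_subtype] at h'
    rwa [inf_eq_right.2 hT.1, inf_eq_right.2 hT'.1] at h'

end Linear

namespace PolarGeometry

/-! ### Counting generators -/

variable {F V : Type*} [Field F] [Finite F] [AddCommGroup V] [Module F V]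
variable [FiniteDimensional F V] {D : PolarGeometry F V}

/-- The generators on a subspace of dimension `d-1`, one of them excepted: choosing a vector `p`
outside that subspace in the exceptional generator, these are counted by means of the singular
vectors `v` orthogonal to the subspace with `form p v = 1`, of which every line in direction `p`
contains at most `κ`. -/
lemma ncard_gens_on_hyperplane_le {d r : ℕ} {κ : ℝ} (hd : D.HasRank d)
    (hdim : finrank F V = 2 * d + r)
    (hκ : ∀ p v, D.Sing p → D.form p v ≠ 0 → ({a : F | D.Sing (v + a • p)}.ncard : ℝ) ≤ κ)
    {y' K : Submodule F V} (hy' : D.IsGen d y') (hKy' : K ≤ y') (hK : finrank F K + 1 = d) :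
    ({y | D.IsGen d y ∧ K ≤ y ∧ y ≠ y'}.ncard : ℝ) ≤ κ * (Nat.card F : ℝ) ^ r := by
  have : Finite V := Module.finite_of_finite F
  have := finite_submodule F V
  have hcard : ∀ W : Submodule F V, (W : Set V).ncard = Nat.card F ^ finrank F W := fun W => by
    rw [← Module.natCard_eq_pow_finrank, ← Nat.card_coe_set_eq]; rfl
  obtain ⟨p, hp, hpK⟩ : ∃ p ∈ y', p ∉ K := by
    by_contra! hcon
    have := Submodule.finrank_mono (show y' ≤ K from hcon)
    have := hy'.2
    omega
  have hps : D.Sing p := (hy'.1 p hp).1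
  have hpy' : ∀ x ∈ y', D.form p x = 0 := (hy'.1 p hp).2
  have hspan : K ⊔ F ∙ p = y' := by
    refine Submodule.eq_of_le_of_finrank_eq
      (sup_le hKy' (by rwa [Submodule.span_singleton_le_iff_mem])) ?_
    rw [finrank_sup_span hpK, hK, hy'.2]
  have hex : ∀ y : Submodule F V, D.IsGen d y ∧ K ≤ y ∧ y ≠ y' → ∃ v ∈ y, D.form p v = 1 := by
    rintro y ⟨hy, hKy, hne⟩
    obtain ⟨v, hv, hvy'⟩ : ∃ v ∈ y, v ∉ y' := by
      by_contra! hcon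
      exact hne (hy.eq_of_le_gen hy' hcon)
    have hpv : D.form p v ≠ 0 := by
      intro h0
      refine hvy' (hy'.mem_of_orth hd (hy.1 v hv).1 ?_)
      rw [← hspan, perp_sup]
      exact ⟨fun k hk => (hy.1 k (hKy hk)).2 v hv, mem_perp_span.2 h0⟩
    exact ⟨(D.form p v)⁻¹ • v, y.smul_mem _ hv, by simp [hpv]⟩
  choose! v hvy hpv using hex
  let A : Set (Submodule F V) := {y | D.IsGen d y ∧ K ≤ y ∧ y ≠ y'}
  let X : Set V := {w | w ∈ D.perp K ∧ D.form p w = 1 ∧ D.Sing w}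
  let X₀ : Set V := {w | w ∈ D.perp K ∧ D.form p w = 1}
  have h1 : A.ncard * Nat.card F ^ finrank F K ≤ X.ncard := by
    rw [← hcard, ← Set.ncard_prod]
    refine Set.ncard_le_ncard_of_injOn (fun x => v x.1 + x.2) ?_ ?_
    · rintro ⟨y, k⟩ ⟨hy, hk⟩
      have hmem : v y + k ∈ y := y.add_mem (hvy y hy) (hy.2.1 hk)
      refine ⟨fun w hw => (hy.1.1 w (hy.2.1 hw)).2 _ hmem, ?_, (hy.1.1 _ hmem).1⟩
      rw [map_add, hpv y hy, hpy' k (hKy' hk), add_zero]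
    · rintro ⟨y, k⟩ ⟨hy, hk⟩ ⟨z, l⟩ ⟨hz, hl⟩ heq
      have heq : v y + k = v z + l := heq
      have hmem : v y + k ∈ y := y.add_mem (hvy y hy) (hy.2.1 hk)
      have hmem' : v y + k ∈ z := heq ▸ z.add_mem (hvy z hz) (hz.2.1 hl)
      have hnK : v y + k ∉ K := fun h => by
        have h0 := hpy' _ (hKy' h)
        rw [map_add, hpv y hy, hpy' k (hKy' hk), add_zero] at h0
        exact one_ne_zero h0
      have hgen : ∀ x, D.IsGen d x → K ≤ x → v y + k ∈ x → K ⊔ F ∙ (v y + k) = x := by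
        intro x hx hKx hm
        refine Submodule.eq_of_le_of_finrank_eq
          (sup_le hKx (by rwa [Submodule.span_singleton_le_iff_mem])) ?_
        rw [finrank_sup_span hnK, hK, hx.2]
      obtain rfl : y = z := (hgen y hy.1 hy.2.1 hmem).symm.trans (hgen z hz.1 hz.2.1 hmem')
      rw [add_left_cancel heq]
  have h2 : ((X ×ˢ (Set.univ : Set F)).ncard : ℝ) ≤ κ * X₀.ncard := by
    refine ncard_le_mul_of_fiber (fun x => x.1 + x.2 • p) ?_ κ ?_
    · rintro ⟨w, a⟩ ⟨⟨hw, hpw, -⟩, -⟩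
      refine ⟨(D.perp K).add_mem hw ((D.perp K).smul_mem a (perp_anti hKy' (hy'.1.le_perp hp))), ?_⟩
      rw [map_add, hpw, map_smul, hpy' p hp, smul_zero, add_zero]
    · rintro w ⟨-, hpw⟩
      refine le_trans (Nat.cast_le.2 ?_) (hκ p w hps (by rw [hpw]; exact one_ne_zero))
      refine Set.ncard_le_ncard_of_injOn (fun x => -x.2) ?_ ?_
      · rintro ⟨u, a⟩ ⟨⟨⟨-, -, hu⟩, -⟩, heq⟩
        show D.Sing (w + -a • p)
        rw [← heq]
        simpa using hu
      · rintro ⟨u, a⟩ ⟨-, heq⟩ ⟨u', a'⟩ ⟨-, heq'⟩ h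
        obtain rfl : a = a' := neg_injective h
        have h3 : u + a • p = u' + a • p := heq.trans heq'.symm
        rw [add_right_cancel h3]
  have h3 : X₀.ncard ≤ Nat.card F ^ (d + r) := by
    have hperp : finrank F (D.perp y') = d + r := by
      have := hy'.1.finrank_add_finrank_perp
      have := hy'.2
      omega
    rcases X₀.eq_empty_or_nonempty with he | ⟨w₀, hw₀, hpw₀⟩
    · simp [he]
    · rw [← hperp, ← hcard]
      refine Set.ncard_le_ncard_of_injOn (fun w => w - w₀) ?_
        (fun _ _ _ _ h => sub_left_injective h)
      rintro w ⟨hw, hpw⟩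
      show w - w₀ ∈ D.perp y'
      rw [← hspan, perp_sup]
      exact ⟨(D.perp K).sub_mem hw hw₀, mem_perp_span.2 (by rw [map_sub, hpw, hpw₀, sub_self])⟩
  have h0 : 0 ≤ κ := by
    by_cases h : ∃ w, D.form p w ≠ 0
    · obtain ⟨w, hw⟩ := h
      exact (Nat.cast_nonneg _).trans (hκ p w hps hw)
    · push Not at h
      exact absurd (D.eq_zero_of_sing hps h ▸ K.zero_mem) hpK
  rw [Set.ncard_prod, Set.ncard_univ] at h2
  have hqd : (0 : ℝ) < (Nat.card F : ℝ) ^ d := pow_pos (Nat.cast_pos.2 Nat.card_pos) d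
  have h1' : (A.ncard : ℝ) * (Nat.card F : ℝ) ^ finrank F K ≤ X.ncard := by exact_mod_cast h1
  have h3' : (X₀.ncard : ℝ) ≤ (Nat.card F : ℝ) ^ (d + r) := by exact_mod_cast h3
  push_cast at h2
  have hA : (A.ncard : ℝ) * (Nat.card F : ℝ) ^ d ≤ κ * (Nat.card F : ℝ) ^ r *
      (Nat.card F : ℝ) ^ d := by
    calc (A.ncard : ℝ) * (Nat.card F : ℝ) ^ d
        = (A.ncard : ℝ) * (Nat.card F : ℝ) ^ finrank F K * Nat.card F := by
          rw [← hK, pow_succ, mul_assoc]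
      _ ≤ X.ncard * Nat.card F := by gcongr
      _ ≤ κ * X₀.ncard := h2
      _ ≤ κ * (Nat.card F : ℝ) ^ (d + r) := by gcongr
      _ = _ := by rw [pow_add]; ring
  exact le_of_mul_le_mul_right hA hqd

variable (D) in
/-- Every subspace of dimension `d-1` of a generator lies in at most `c` other generators. -/
def LineBound (d : ℕ) (c : ℝ) : Prop :=
  ∀ y' K : Submodule F V, D.IsGen d y' → K ≤ y' → finrank F K + 1 = d →
    ({y | D.IsGen d y ∧ K ≤ y ∧ y ≠ y'}.ncard : ℝ) ≤ c

/-- The number of generators that meet a generator `R` exactly in a given subspace `Z` of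
codimension `k`. A point `p` of `R` outside `Z` maps such a generator `y` to the generator spanned
by `p` and the vectors of `y` orthogonal to `p`, which meets `R` in the span of `Z` and `p`. -/
lemma ncard_inf_eq_le {d : ℕ} {c : ℝ} (hd : D.HasRank d) (hc : D.LineBound d c) {k : ℕ}
    {R Z : Submodule F V} (hR : D.IsGen d R) (hZ : Z ≤ R) (hk : finrank F Z + k = d) :
    ({y | D.IsGen d y ∧ y ⊓ R = Z}.ncard : ℝ) ≤ c ^ k * (Nat.card F : ℝ) ^ (k.choose 2) := by
  have := finite_submodule F V
  induction k generalizing Z with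
  | zero =>
    have hZR : Z = R := Submodule.eq_of_le_of_finrank_eq hZ (by rw [hR.2, ← hk, add_zero])
    have hsub : {y | D.IsGen d y ∧ y ⊓ R = Z} ⊆ {R} := by
      rintro y ⟨hy, hyR⟩
      rw [hZR, inf_eq_right] at hyR
      exact (hR.eq_of_le_gen hy hyR).symm
    have := Set.ncard_le_ncard hsub
    rw [Set.ncard_singleton] at this
    simpa using this
  | succ k ih =>
    obtain ⟨p, hp, hpZ⟩ : ∃ p ∈ R, p ∉ Z := by
      by_contra! hcon
      have := Submodule.finrank_mono (show R ≤ Z from hcon)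
      have := hR.2
      omega
    have hps : D.Sing p := (hR.1 p hp).1
    have hspR : F ∙ p ≤ R := by rwa [Submodule.span_singleton_le_iff_mem]
    have hZ1 := finrank_sup_span hpZ
    have hZp : Z ≤ D.perp (F ∙ p) := hZ.trans (hR.1.le_perp.trans (perp_anti hspR))
    have hc0 : 0 ≤ c := by
      obtain ⟨K, hKR, hK⟩ := exists_le_finrank_eq R (k := d - 1) (by rw [hR.2]; omega)
      exact (Nat.cast_nonneg _).trans (hc R K hR hKR (by omega))
    set A : Set (Submodule F V) := {y | D.IsGen d y ∧ y ⊓ R = Z}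
    set B : Set (Submodule F V) := {y | D.IsGen d y ∧ y ⊓ R = Z ⊔ F ∙ p}
    have hB := ih (sup_le hZ hspR) (by omega)
    have hpA : ∀ y ∈ A, p ∉ y := fun y hy hpy => hpZ (hy.2.le ⟨hpy, hp⟩)
    have hmaps : ∀ y ∈ A, y ⊓ D.perp (F ∙ p) ⊔ F ∙ p ∈ B := by
      intro y hy
      refine ⟨(hy.1.project hd hps (hpA y hy)).1, ?_⟩
      rw [sup_comm, sup_inf_assoc_of_le _ hspR, inf_assoc, inf_comm (D.perp _), ← inf_assoc, hy.2,
        inf_eq_left.2 hZp, sup_comm]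
    have hfib : ∀ y' ∈ B, ({y ∈ A | y ⊓ D.perp (F ∙ p) ⊔ F ∙ p = y'}.ncard : ℝ) ≤
        c * (Nat.card F : ℝ) ^ k := by
      rintro y' ⟨hy', hy'R⟩
      have hZpy' : Z ⊔ F ∙ p ≤ y' := hy'R ▸ inf_le_left
      have hpy' : p ∈ y' :=
        hZpy' (Submodule.mem_sup_right (Submodule.mem_span_singleton_self p))
      have hK := ncard_hyperplanes_le (le_sup_left.trans hZpy') hpy' hpZ (k := k)
        (by rw [hy'.2]; omega)
      refine le_trans (ncard_le_mul_of_fiber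
        (B := {K : Submodule F V | Z ≤ K ∧ K ≤ y' ∧ p ∉ K ∧ finrank F K + 1 = finrank F y'})
        (fun y => y ⊓ D.perp (F ∙ p)) ?_ c ?_)
        (mul_le_mul_of_nonneg_left (by exact_mod_cast hK) hc0)
      · rintro y ⟨hyA, heq⟩
        exact ⟨le_inf (hyA.2 ▸ inf_le_left) hZp, heq ▸ le_sup_left, fun h => hpA y hyA h.1,
          by rw [hy'.2]; exact (hyA.1.project hd hps (hpA y hyA)).2⟩
      · rintro K ⟨-, hKy', -, hKdim⟩
        refine le_trans (Nat.cast_le.2 (Set.ncard_le_ncard ?_)) (hc y' K hy' hKy' (by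
          rw [hKdim, hy'.2]))
        rintro y ⟨⟨hyA, -⟩, rfl⟩
        exact ⟨hyA.1, inf_le_left, fun h => hpA y hyA (h ▸ hpy')⟩
    calc (A.ncard : ℝ) ≤ c * (Nat.card F : ℝ) ^ k * B.ncard :=
          ncard_le_mul_of_fiber _ hmaps _ hfib
      _ ≤ c * (Nat.card F : ℝ) ^ k * (c ^ k * (Nat.card F : ℝ) ^ (k.choose 2)) := by gcongr
      _ = c ^ (k + 1) * (Nat.card F : ℝ) ^ ((k + 1).choose 2) := by
          rw [Nat.choose_succ_succ' k 1, Nat.choose_one_right, pow_add, pow_succ]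
          ring

omit [Finite F] [FiniteDimensional F V] in
/-- The preimages of a subspace `Z ≤ U` and of its intersection with `S` under a parametrization of
`U` that maps the coordinate subspace of dimension `a` onto `S`. -/
lemma finrank_comap_inf_coordSpace {n : ℕ} {j : (Fin n → F) →ₗ[F] V} (hj : Function.Injective j)
    {S Z : Submodule F V} {a : ℤ} (hS : (coordSpace F n a).map j = S) :
    finrank F ↥(Z.comap j ⊓ coordSpace F n a) = finrank F ↥(Z ⊓ S) := by
  have hle : S ≤ LinearMap.range j := hS ▸ LinearMap.map_le_range
  have : coordSpace F n a = S.comap j := by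
    rw [← hS, Submodule.comap_map_eq_of_injective hj]
  rw [this, ← Submodule.comap_inf, finrank_comap_of_injective hj,
    inf_eq_left.2 (inf_le_right.trans hle)]

omit [Finite F] [FiniteDimensional F V] in
lemma comap_injOn {n : ℕ} {j : (Fin n → F) →ₗ[F] V} {U : Submodule F V}
    (hU : LinearMap.range j = U) {Z Z' : Submodule F V} (hZ : Z ≤ U) (hZ' : Z' ≤ U)
    (h : Z.comap j = Z'.comap j) : Z = Z' := by
  have h' := congrArg (Submodule.map j) h
  rwa [Submodule.map_comap_eq, Submodule.map_comap_eq, hU, inf_eq_right.2 hZ,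
    inf_eq_right.2 hZ'] at h'

lemma ncard_le_psi2 {U S : Submodule F V} {n a r u : ℕ} (hSU : S ≤ U)
    (hU : finrank F U = n) (hS : finrank F S = a) :
    {Z : Submodule F V | Z ≤ U ∧ finrank F Z = r ∧ finrank F ↥(Z ⊓ S) = u}.ncard ≤
      psi2 F n r a u := by
  obtain ⟨j, hj, hrange, hjS, -⟩ := exists_injective_map_coordSpace le_rfl hSU hS hS hU
  have := finite_submodule F (Fin n → F)
  have han : a ≤ n := hS ▸ hU ▸ Submodule.finrank_mono hSU
  rw [psi2, if_pos (by omega)]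
  refine Set.ncard_le_ncard_of_injOn (fun Z => Z.comap j) ?_
    (fun Z hZ Z' hZ' h => comap_injOn hrange hZ.1 hZ'.1 h)
  rintro Z ⟨hZU, hZ, hZS⟩
  refine ⟨?_, ?_⟩
  · show (finrank F (Z.comap j) : ℤ) = r
    rw [finrank_comap_of_injective hj, hrange, inf_eq_left.2 hZU, hZ]
  · show (finrank F ↥(Z.comap j ⊓ coordSpace F n a) : ℤ) = u
    rw [finrank_comap_inf_coordSpace hj hjS, hZS]

lemma ncard_le_psi3 {U S T : Submodule F V} {n a b r u v : ℕ} (hTS : T ≤ S) (hSU : S ≤ U)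
    (hU : finrank F U = n) (hS : finrank F S = a) (hT : finrank F T = b) :
    {Z : Submodule F V | Z ≤ U ∧ finrank F Z = r ∧ finrank F ↥(Z ⊓ S) = u ∧
      finrank F ↥(Z ⊓ T) = v}.ncard ≤ psi3 F n a b r v u := by
  obtain ⟨j, hj, hrange, hjS, hjT⟩ := exists_injective_map_coordSpace hTS hSU hT hS hU
  have := finite_submodule F (Fin n → F)
  have han : a ≤ n := hS ▸ hU ▸ Submodule.finrank_mono hSU
  have hba : b ≤ a := hT ▸ hS ▸ Submodule.finrank_mono hTS
  rw [psi3, if_pos (by omega)]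
  refine Set.ncard_le_ncard_of_injOn (fun Z => Z.comap j) ?_
    (fun Z hZ Z' hZ' h => comap_injOn hrange hZ.1 hZ'.1 h)
  rintro Z ⟨hZU, hZ, hZS, hZT⟩
  refine ⟨?_, ?_, ?_⟩
  · show (finrank F (Z.comap j) : ℤ) = r
    rw [finrank_comap_of_injective hj, hrange, inf_eq_left.2 hZU, hZ]
  · show (finrank F ↥(Z.comap j ⊓ coordSpace F n a) : ℤ) = u
    rw [finrank_comap_inf_coordSpace hj hjS, hZS]
  · show (finrank F ↥(Z.comap j ⊓ coordSpace F n b) : ℤ) = v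
    rw [finrank_comap_inf_coordSpace hj hjT, hZT]

omit [Finite F] [FiniteDimensional F V] in
lemma inf_inf_of_le {y A S : Submodule F V} (h : S ≤ A) : y ⊓ A ⊓ S = y ⊓ S := by
  rw [inf_assoc, inf_eq_right.2 h]

/-- Generators that meet a generator `R` in codimension `m` and a subspace `S` of it in dimension
`e`. -/
lemma ncard_inf_gen_le {m e : ℕ} {c : ℝ} (hd : D.HasRank (4 * m + 1 + e))
    (hc : D.LineBound (4 * m + 1 + e) c) {R S : Submodule F V} (hR : D.IsGen (4 * m + 1 + e) R)
    (hSR : S ≤ R) (hS : finrank F S = e + m) :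
    ({y | D.IsGen (4 * m + 1 + e) y ∧ finrank F ↥(y ⊓ R) = e + 3 * m + 1 ∧
        finrank F ↥(y ⊓ S) = e}.ncard : ℝ) ≤
      c ^ m * (Nat.card F : ℝ) ^ (m.choose 2) *
        psi2 F (4 * m + 1 + e) (e + 3 * m + 1 : ℕ) (e + m : ℕ) e := by
  have := finite_submodule F V
  have hpos : 0 ≤ c ^ m * (Nat.card F : ℝ) ^ (m.choose 2) := by
    obtain ⟨Z, hZR, hZ⟩ := exists_le_finrank_eq R (k := e + 3 * m + 1) (by rw [hR.2]; omega)
    exact (Nat.cast_nonneg _).trans (ncard_inf_eq_le hd hc hR hZR (k := m) (by omega))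
  refine le_trans (ncard_le_mul_of_fiber (fun y => y ⊓ R)
    (B := {Z : Submodule F V | Z ≤ R ∧ finrank F Z = e + 3 * m + 1 ∧ finrank F ↥(Z ⊓ S) = e})
    ?_ (c ^ m * (Nat.card F : ℝ) ^ (m.choose 2)) ?_)
    (mul_le_mul_of_nonneg_left (Nat.cast_le.2 (ncard_le_psi2 hSR hR.2 hS)) hpos)
  · rintro y ⟨-, hyR, hyS⟩
    exact ⟨inf_le_right, hyR, by rw [inf_inf_of_le hSR, hyS]⟩
  · rintro Z ⟨hZR, hZ, -⟩
    refine le_trans (Nat.cast_le.2 (Set.ncard_le_ncard ?_))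
      (ncard_inf_eq_le hd hc hR hZR (k := m) (by omega))
    rintro y ⟨⟨hy, -⟩, hyZ⟩
    exact ⟨hy, hyZ⟩

/-- Generators that meet a totally isotropic subspace `U` of dimension `d-1` in codimension `m`, a
subspace `S` of it in dimension `e`, and an `(e+1)`-space of `S` in more than the generic
dimension. -/
lemma ncard_inf_flag_le {m e N : ℕ}
    (hN : ∀ Z, D.IsTI Z → finrank F Z = e + 3 * m →
      {y | D.IsGen (4 * m + 1 + e) y ∧ Z ≤ y}.ncard ≤ N) {U S T : Submodule F V} (hU : D.IsTI U)
    (hUdim : finrank F U = e + 4 * m) (hSU : S ≤ U) (hS : finrank F S = e + m) (hTS : T ≤ S)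
    (hT : finrank F T = e + 1) :
    {y | D.IsGen (4 * m + 1 + e) y ∧ finrank F ↥(y ⊓ U) = e + 3 * m ∧
        finrank F ↥(y ⊓ S) = e ∧ e + 2 ≤ finrank F ↥(y ⊓ T) + m}.ncard ≤
      N * ∑ i ∈ Finset.Icc 1 (m - 1), psi3 F (e + 4 * m) (e + m : ℕ) (e + 1 : ℕ) (e + 3 * m : ℕ)
        (e + 1 - m + i : ℤ) e := by
  have := finite_submodule F V
  set B : Set (Submodule F V) := {Z | Z ≤ U ∧ finrank F Z = e + 3 * m ∧
    finrank F ↥(Z ⊓ S) = e ∧ e + 2 ≤ finrank F ↥(Z ⊓ T) + m}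
  have hB : B.ncard ≤ ∑ i ∈ Finset.Icc 1 (m - 1),
      psi3 F (e + 4 * m) (e + m : ℕ) (e + 1 : ℕ) (e + 3 * m : ℕ) (e + 1 - m + i : ℤ) e := by
    have hsub : B ⊆ ⋃ i ∈ Finset.Icc 1 (m - 1), {Z | Z ∈ B ∧ finrank F ↥(Z ⊓ T) + m = e + 1 + i} := by
      intro Z hZ
      have h1 := Submodule.finrank_mono (inf_le_inf_left Z hTS)
      have h2 := hZ.2.2.1
      have h3 := hZ.2.2.2
      simp only [Set.mem_iUnion]
      refine ⟨finrank F ↥(Z ⊓ T) + m - (e + 1), Finset.mem_Icc.2 ⟨by omega, by omega⟩, hZ, by omega⟩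
    refine (Set.ncard_le_ncard hsub).trans ((Finset.set_ncard_biUnion_le _ _).trans
      (Finset.sum_le_sum fun i hi => ?_))
    rcases Nat.lt_or_ge (e + 1 + i) m with hlt | hge
    · have : {Z | Z ∈ B ∧ finrank F ↥(Z ⊓ T) + m = e + 1 + i} = ∅ := by
        ext Z
        simp only [Set.mem_ofPred_eq, Set.mem_empty_iff_false, iff_false, not_and]
        intro _
        omega
      rw [this, Set.ncard_empty]
      exact Nat.zero_le _
    · have hcast : (e + 1 - m + i : ℤ) = (e + 1 + i - m : ℕ) := by
        rw [Nat.cast_sub hge]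
        push_cast
        ring
      rw [hcast]
      refine le_trans (Set.ncard_le_ncard ?_) (ncard_le_psi3 hTS hSU hUdim hS hT)
      rintro Z ⟨⟨h1, h2, h3, -⟩, h4⟩
      exact ⟨h1, h2, h3, by omega⟩
  have hmain : (({y | D.IsGen (4 * m + 1 + e) y ∧ finrank F ↥(y ⊓ U) = e + 3 * m ∧
        finrank F ↥(y ⊓ S) = e ∧ e + 2 ≤ finrank F ↥(y ⊓ T) + m}.ncard : ℕ) : ℝ) ≤
      N * B.ncard := by
    refine ncard_le_mul_of_fiber (fun y => y ⊓ U) ?_ N ?_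
    · rintro y ⟨-, h1, h2, h3⟩
      exact ⟨inf_le_right, h1, by rwa [inf_inf_of_le hSU],
        by rwa [inf_inf_of_le (hTS.trans hSU)]⟩
    · rintro Z ⟨hZU, hZ, -⟩
      refine Nat.cast_le.2 (le_trans (Set.ncard_le_ncard ?_) (hN Z (hU.mono hZU) hZ))
      rintro y ⟨⟨hy, -⟩, rfl⟩
      exact ⟨hy, inf_le_left⟩
  exact le_trans (by exact_mod_cast hmain) (Nat.mul_le_mul_left N hB)

end PolarGeometry

/-! ### The geometry of a classical form -/

/-- The solutions of `x + σ x = c`, where `σ` is an involution of a finite field: their number is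
at most the square root of the order of the field. -/
lemma ncard_add_apply_eq_sq_le {F : Type*} [Field F] [Finite F] {σ : F →+* F}
    (hne : σ ≠ RingHom.id F) (c : F) : {x : F | x + σ x = c}.ncard ^ 2 ≤ Nat.card F := by
  obtain ⟨θ, hθ⟩ : ∃ θ, σ θ ≠ θ := by
    by_contra! hcon
    exact hne (RingHom.ext hcon)
  set A := {x : F | x + σ x = c}
  rw [sq, ← Set.ncard_prod, ← Set.ncard_univ F]
  -- a difference `u` of two solutions has `σ u = -u`
  refine Set.ncard_le_ncard_of_injOn (fun x => x.1 + θ * x.2) (fun _ _ => Set.mem_univ _) ?_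
  rintro ⟨x, y⟩ ⟨hx, hy⟩ ⟨x', y'⟩ ⟨hx', hy'⟩ h
  have hx : x + σ x = c := hx
  have hy : y + σ y = c := hy
  have hx' : x' + σ x' = c := hx'
  have hy' : y' + σ y' = c := hy'
  have h : x + θ * y = x' + θ * y' := h
  have h2 : σ x + σ θ * σ y = σ x' + σ θ * σ y' := by
    rw [← map_mul, ← map_mul, ← map_add, ← map_add, h]
  have h3 : (θ - σ θ) * (y - y') = 0 := by
    linear_combination h + h2 - hx + hx' - σ θ * hy + σ θ * hy'
  have h4 : y = y' := by
    rcases mul_eq_zero.1 h3 with h0 | h0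
    · exact absurd (sub_eq_zero.1 h0).symm hθ
    · exact sub_eq_zero.1 h0
  subst h4
  rw [add_right_cancel h]

lemma exists_add_apply_eq {F : Type*} [Field F] {σ : F →+* F} (hinv : Function.Involutive σ)
    (hne : σ ≠ RingHom.id F) {c : F} (hc : σ c = c) : ∃ x, x + σ x = c := by
  obtain ⟨y, hy⟩ : ∃ y, y + σ y ≠ 0 := by
    by_contra! hcon
    have h2 : (1 : F) + 1 = 0 := by simpa using hcon 1
    refine hne (RingHom.ext fun x => ?_)
    have := hcon x
    rw [RingHom.id_apply]
    linear_combination this - x * h2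
  refine ⟨c * y / (y + σ y), ?_⟩
  rw [map_div₀, map_mul, map_add, hinv y, hc, add_comm (σ y) y]
  field_simp

namespace PolarForm

variable {F V : Type*} [Field F] [AddCommGroup V] [Module F V]

lemma apply_add_smul_of_apply_eq_zero {Q : QuadraticForm F V} {p : V} (hp : Q p = 0) (v : V)
    (a : F) : Q (v + a • p) = Q v + a * Q.polarBilin p v := by
  rw [QuadraticMap.map_add Q, QuadraticMap.map_smul, hp, QuadraticMap.polar_comm,
    QuadraticMap.polar_smul_left, ← QuadraticMap.polarBilin_apply_apply]
  simp

/-- The polar geometry defined by a quadratic, Hermitian or alternating form. -/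
def geometry : PolarForm F V → PolarGeometry F V
  | quadratic Q nondeg =>
    { σ := RingHom.id F
      invol := fun _ => rfl
      form := Q.polarBilin
      refl := fun x y h => by
        rw [QuadraticMap.polarBilin_apply_apply] at h ⊢
        rwa [QuadraticMap.polar_comm]
      Sing := fun v => Q v = 0
      sing_smul := fun a v h => by rw [QuadraticMap.map_smul, h, smul_zero]
      sing_add := fun {v w} hv hw h => by
        rw [QuadraticMap.polarBilin_apply_apply] at h
        rw [QuadraticMap.map_add Q, hv, hw, h, add_zero, add_zero]
      self_orth := fun {v} h => by
        rw [QuadraticMap.polarBilin_apply_apply, QuadraticMap.polar_self, h, smul_zero]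
      eq_zero_of_sing := fun {v} h hv => by
        have : v ∈ Q.radical := ⟨h, LinearMap.ext hv⟩
        rwa [nondeg.radical_eq_bot, Submodule.mem_bot] at this
      exists_secant := fun {p v} hp h => by
        refine ⟨-Q v / Q.polarBilin p v, ?_⟩
        rw [apply_add_smul_of_apply_eq_zero hp, div_mul_cancel₀ _ h]
        ring }
  | hermitian σ invol ne_id B symm nondeg =>
    { σ := σ
      invol := invol
      form := B
      refl := symm.isRefl
      Sing := fun v => B v v = 0
      sing_smul := fun a v h => by simp [h]
      sing_add := fun {v w} hv hw h => by simp [hv, hw, h, symm.isRefl v w h]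
      self_orth := fun h => h
      eq_zero_of_sing := fun _ hv => nondeg.1 _ hv
      exists_secant := fun {p v} hp h => by
        obtain ⟨x, hx⟩ := exists_add_apply_eq invol ne_id (c := -B v v)
          (by rw [map_neg, symm.eq])
        have h' : B v p ≠ 0 := fun h0 => h (symm.isRefl _ _ h0)
        refine ⟨x / B v p, ?_⟩
        have h1 : σ (B v p) = B p v := symm.eq v p
        simp only [map_add, LinearMap.map_smulₛₗ, LinearMap.add_apply, LinearMap.smul_apply,
          smul_eq_mul, map_smul, map_div₀, hp, h1]
        field_simp
        linear_combination (B p v * B v p) * hx }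
  | symplectic B alt nondeg =>
    { σ := RingHom.id F
      invol := fun _ => rfl
      form := B
      refl := alt.isRefl
      Sing := fun _ => True
      sing_smul := fun _ _ _ => trivial
      sing_add := fun _ _ _ => trivial
      self_orth := fun {v} _ => alt v
      eq_zero_of_sing := fun _ hv => nondeg.1 _ hv
      exists_secant := fun _ _ => ⟨0, trivial⟩ }

lemma isTI_geometry_iff (P : PolarForm F V) {W : Submodule F V} :
    P.geometry.IsTI W ↔ P.IsTotallyIsotropic W := by
  cases P with
  | quadratic Q nondeg =>
    refine ⟨fun h v hv => (h v hv).1, fun h v hv => ⟨h v hv, fun w hw => ?_⟩⟩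
    show Q.polarBilin v w = 0
    rw [QuadraticMap.polarBilin_apply_apply, QuadraticMap.polar, h _ (W.add_mem hv hw), h v hv,
      h w hw, sub_zero, sub_zero]
  | hermitian σ invol ne_id B symm nondeg =>
    exact ⟨fun h v hv => (h v hv).2, fun h v hv => ⟨h v hv v hv, h v hv⟩⟩
  | symplectic B alt nondeg =>
    exact ⟨fun h v hv => (h v hv).2, fun h v hv => ⟨trivial, h v hv⟩⟩

lemma maximal_isTI_geometry_iff (P : PolarForm F V) {G : Submodule F V} :
    Maximal P.geometry.IsTI G ↔ P.IsGenerator G := by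
  have : P.geometry.IsTI = P.IsTotallyIsotropic := funext fun _ => propext P.isTI_geometry_iff
  rw [IsGenerator, this]

variable [FiniteDimensional F V]

lemma HasRank.geometry {P : PolarForm F V} {d : ℕ} (h : P.HasRank d) : P.geometry.HasRank d := by
  obtain ⟨G, hG, rfl⟩ := h
  exact PolarGeometry.hasRank_of_maximal (P.maximal_isTI_geometry_iff.2 hG)

lemma isGenerator_iff {P : PolarForm F V} {d : ℕ} (h : P.HasRank d) {G : Submodule F V} :
    P.IsGenerator G ↔ P.geometry.IsGen d G := by
  rw [← P.maximal_isTI_geometry_iff, h.geometry.maximal_iff]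

/-- In a polar space of type `τ`, every subspace of dimension `d-1` of a generator lies in at most
`q^ε` other generators. -/
lemma lineBound [Finite F] {P : PolarForm F V} {τ : PolarType} {d : ℕ} (hP : P.IsPolarSpace τ d) :
    P.geometry.LineBound d ((Nat.card F : ℝ) ^ τ.eps) := by
  obtain ⟨hkind, hdim, hrank⟩ := hP
  have hd := hrank.geometry
  intro y' K hy' hK hKdim
  have hq : (0 : ℝ) < Nat.card F := Nat.cast_pos.2 Nat.card_pos
  cases P with
  | quadratic Q nondeg =>
    have hκ : ∀ p v, (quadratic Q nondeg).geometry.Sing p →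
        (quadratic Q nondeg).geometry.form p v ≠ 0 →
        ({a : F | (quadratic Q nondeg).geometry.Sing (v + a • p)}.ncard : ℝ) ≤ 1 := by
      intro p v hp hpv
      have hp : Q p = 0 := hp
      have hpv : Q.polarBilin p v ≠ 0 := hpv
      have hsub : {a : F | (quadratic Q nondeg).geometry.Sing (v + a • p)}.Subsingleton := by
        intro a ha b hb
        have ha : Q (v + a • p) = 0 := ha
        have hb : Q (v + b • p) = 0 := hb
        rw [apply_add_smul_of_apply_eq_zero hp] at ha hb
        exact mul_right_cancel₀ hpv (add_left_cancel (ha.trans hb.symm))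
      exact_mod_cast Set.ncard_le_one_iff_subsingleton.2 hsub
    cases τ with
    | hyperbolic =>
      have := PolarGeometry.ncard_gens_on_hyperplane_le (r := 0) hd hdim hκ hy' hK hKdim
      simpa [PolarType.eps] using this
    | parabolic =>
      have := PolarGeometry.ncard_gens_on_hyperplane_le (r := 1) hd hdim hκ hy' hK hKdim
      simpa [PolarType.eps] using this
    | elliptic =>
      have := PolarGeometry.ncard_gens_on_hyperplane_le (r := 2) hd hdim hκ hy' hK hKdim
      simpa [PolarType.eps] using this
    | hermitianOdd => exact hkind.elim
    | hermitianEven => exact hkind.elim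
    | symplectic => exact hkind.elim
  | hermitian σ invol ne_id B symm nondeg =>
    have hκ : ∀ p v, (hermitian σ invol ne_id B symm nondeg).geometry.Sing p →
        (hermitian σ invol ne_id B symm nondeg).geometry.form p v ≠ 0 →
        ({a : F | (hermitian σ invol ne_id B symm nondeg).geometry.Sing (v + a • p)}.ncard : ℝ) ≤
          (Nat.card F : ℝ) ^ (1 / 2 : ℝ) := by
      intro p v hp hpv
      have hp : B p p = 0 := hp
      have hpv : B p v ≠ 0 := hpv
      have hvp : B v p ≠ 0 := fun h0 => hpv (symm.isRefl _ _ h0)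
      have hsq := ncard_add_apply_eq_sq_le ne_id (-B v v)
      have hle : {a : F | (hermitian σ invol ne_id B symm nondeg).geometry.Sing (v + a • p)}.ncard ≤
          {x : F | x + σ x = -B v v}.ncard := by
        refine Set.ncard_le_ncard_of_injOn (fun a => a * B v p) ?_
          (fun a _ b _ h => mul_right_cancel₀ hvp h)
        intro a ha
        have ha : B (v + a • p) (v + a • p) = 0 := ha
        show a * B v p + σ (a * B v p) = -B v v
        rw [map_mul, symm.eq v p]
        simp only [map_add, LinearMap.map_smulₛₗ, LinearMap.add_apply, LinearMap.smul_apply,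
          smul_eq_mul, map_smul, hp] at ha
        linear_combination ha
      rw [← Real.sqrt_eq_rpow]
      refine Real.le_sqrt_of_sq_le ?_
      exact_mod_cast (Nat.pow_le_pow_left hle 2).trans hsq
    cases τ with
    | hermitianOdd =>
      have := PolarGeometry.ncard_gens_on_hyperplane_le (r := 0) hd hdim hκ hy' hK hKdim
      simpa [PolarType.eps] using this
    | hermitianEven =>
      have := PolarGeometry.ncard_gens_on_hyperplane_le (r := 1) hd hdim hκ hy' hK hKdim
      refine this.trans (le_of_eq ?_)
      rw [pow_one, ← Real.rpow_add_one hq.ne']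
      norm_num [PolarType.eps]
    | hyperbolic => exact hkind.elim
    | parabolic => exact hkind.elim
    | elliptic => exact hkind.elim
    | symplectic => exact hkind.elim
  | symplectic B alt nondeg =>
    have hκ : ∀ p v, (symplectic B alt nondeg).geometry.Sing p →
        (symplectic B alt nondeg).geometry.form p v ≠ 0 →
        ({a : F | (symplectic B alt nondeg).geometry.Sing (v + a • p)}.ncard : ℝ) ≤ Nat.card F := by
      intro p v _ _
      rw [← Set.ncard_univ F]
      exact Nat.cast_le.2 (Set.ncard_le_ncard (Set.subset_univ _))
    cases τ with
    | symplectic =>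
      have := PolarGeometry.ncard_gens_on_hyperplane_le (r := 0) hd hdim hκ hy' hK hKdim
      simpa [PolarType.eps] using this
    | hyperbolic => exact hkind.elim
    | parabolic => exact hkind.elim
    | elliptic => exact hkind.elim
    | hermitianOdd => exact hkind.elim
    | hermitianEven => exact hkind.elim

end PolarForm

/-! ### Residues: the generators on a totally isotropic subspace -/

namespace PolarGeometry

variable {F V : Type*} [Field F] [AddCommGroup V] [Module F V] {D : PolarGeometry F V}
variable [FiniteDimensional F V]

/-- A complement `M` of `T` in its orthogonal contains no nonzero singular vector orthogonal to
`M`. -/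
lemma eq_zero_of_mem_compl {T M : Submodule F V} (hT : D.IsTI T) (hTM : T ⊓ M = ⊥)
    (hsup : T ⊔ M = D.perp T) {x : V} (hx : x ∈ M) (hs : D.Sing x)
    (horth : ∀ w ∈ M, D.form x w = 0) : x = 0 := by
  by_contra hx0
  have hxT : x ∉ T := fun h => hx0 ((Submodule.mem_bot F).1 (hTM ▸ ⟨h, hx⟩))
  have hMT : M ≤ D.perp T := hsup ▸ le_sup_right
  have hTx : T ≤ D.perp (F ∙ x) := by
    rw [le_perp_comm, Submodule.span_singleton_le_iff_mem]
    exact hMT hx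
  have h1 := (hT.sup (isTI_span hs) hTx).finrank_add_finrank_perp
  have h2 := hT.finrank_add_finrank_perp
  have h3 : D.perp T ≤ D.perp (T ⊔ F ∙ x) := by
    rw [perp_sup]
    refine le_inf le_rfl (hsup ▸ sup_le hTx fun w hw => mem_perp_span.2 (horth w hw))
  have h4 := Submodule.finrank_mono h3
  rw [finrank_sup_span hxT] at h1
  omega

end PolarGeometry

namespace PolarForm

variable {F V E : Type*} [Field F] [AddCommGroup V] [Module F V] [AddCommGroup E] [Module F E]
variable [FiniteDimensional F V]

/-- The restriction of a nondegenerate quadratic form to a complement `M` of a totally singular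
subspace `T` in its orthogonal is nondegenerate. The polar form on `M` has a radical of dimension
at most one, since together with `T` that radical is orthogonal to `T ⊔ M`. -/
lemma nondegenerate_comp {Q : QuadraticForm F V} (nondeg : Q.Nondegenerate) {T M : Submodule F V}
    (hT : (quadratic Q nondeg).geometry.IsTI T) (hTM : T ⊓ M = ⊥)
    (hsup : T ⊔ M = (quadratic Q nondeg).geometry.perp T) {f : E →ₗ[F] V}
    (hf : Function.Injective f) (hM : LinearMap.range f = M) : (Q.comp f).Nondegenerate := by
  have hpol : ∀ x y, (Q.comp f).polarBilin x y = Q.polarBilin (f x) (f y) := fun x y => by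
    simp only [QuadraticMap.polarBilin_apply_apply, QuadraticMap.polar, QuadraticMap.comp_apply,
      map_add]
  have hfM : ∀ x, f x ∈ M := fun x => hM ▸ LinearMap.mem_range_self f x
  refine ⟨?_, ?_⟩
  · rw [eq_bot_iff]
    rintro x ⟨hx, hx'⟩
    refine (Submodule.mem_bot F).2 (hf ?_)
    rw [map_zero]
    refine PolarGeometry.eq_zero_of_mem_compl hT hTM hsup (hfM x) hx fun w hw => ?_
    obtain ⟨y, rfl⟩ : w ∈ LinearMap.range f := hM ▸ hw
    show Q.polarBilin (f x) (f y) = 0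
    rw [← hpol, hx', LinearMap.zero_apply]
  · have : FiniteDimensional F E := Module.Finite.of_injective f hf
    rw [← finrank_eq_rank]
    have hrad : finrank F (LinearMap.ker Q.polarBilin) ≤ 1 := by
      have := nondeg.rank_rad_polar_le
      rw [← finrank_eq_rank] at this
      exact_mod_cast this
    obtain ⟨N, hN⟩ : ∃ N, N = (LinearMap.ker (Q.comp f).polarBilin).map f := ⟨_, rfl⟩
    have hNM : N ≤ M := by
      rw [hN, ← hM]
      exact LinearMap.map_le_range
    have hNdim : finrank F N = finrank F (LinearMap.ker (Q.comp f).polarBilin) := by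
      rw [hN, finrank_map_of_injective hf]
    have hdisj : T ⊓ N = ⊥ := eq_bot_iff.2 (hTM ▸ inf_le_inf_left T hNM)
    have h1 := Submodule.finrank_sup_add_finrank_inf_eq T N
    have h2 := LinearMap.BilinForm.finrank_add_finrank_orthogonal' (B := Q.polarBilin) (T ⊔ N)
    have h3 := hT.finrank_add_finrank_perp
    have h4 : (quadratic Q nondeg).geometry.perp T ≤
        LinearMap.BilinForm.orthogonal Q.polarBilin (T ⊔ N) := by
      have hle : (quadratic Q nondeg).geometry.perp T ≤
          (quadratic Q nondeg).geometry.perp (T ⊔ N) := by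
        rw [PolarGeometry.perp_sup]
        refine le_inf le_rfl (hsup ▸ sup_le ?_ fun w hw z hz => ?_)
        · rw [PolarGeometry.le_perp_comm]
          exact hNM.trans (hsup ▸ le_sup_right)
        · rw [hN] at hz
          obtain ⟨x, hx, rfl⟩ := hz
          obtain ⟨y, rfl⟩ : w ∈ LinearMap.range f := hM ▸ hw
          show Q.polarBilin (f x) (f y) = 0
          rw [← hpol, LinearMap.mem_ker.1 hx, LinearMap.zero_apply]
      exact hle
    have h5 := Submodule.finrank_mono h4
    have h6 : finrank F ↥((T ⊔ N) ⊓ LinearMap.ker Q.polarBilin) ≤ _ :=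
      Submodule.finrank_mono inf_le_right
    rw [hdisj, finrank_bot] at h1
    have : finrank F (LinearMap.ker (Q.comp f).polarBilin) ≤ 1 := by omega
    exact_mod_cast this

/-- The form induced on a complement `M` of a totally isotropic subspace `T` in its orthogonal, in
coordinates on `M` given by an injective linear map `f`. -/
lemma exists_residue (P : PolarForm F V) {T M : Submodule F V} (hT : P.geometry.IsTI T)
    (hTM : T ⊓ M = ⊥) (hsup : T ⊔ M = P.geometry.perp T) {f : E →ₗ[F] V}
    (hf : Function.Injective f) (hM : LinearMap.range f = M) :
    ∃ P' : PolarForm F E, (∀ τ, P.HasKind τ → P'.HasKind τ) ∧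
      ∀ W, P'.geometry.IsTI W ↔ P.geometry.IsTI (W.map f) := by
  have hzero : ∀ x, P.geometry.Sing (f x) → (∀ y, P.geometry.form (f x) (f y) = 0) → x = 0 := by
    intro x hx hxy
    refine hf ?_
    rw [map_zero]
    refine PolarGeometry.eq_zero_of_mem_compl hT hTM hsup (hM ▸ LinearMap.mem_range_self f x) hx
      fun w hw => ?_
    obtain ⟨y, rfl⟩ : w ∈ LinearMap.range f := hM ▸ hw
    exact hxy y
  cases P with
  | quadratic Q nondeg =>
    refine ⟨quadratic (Q.comp f) (nondegenerate_comp nondeg hT hTM hsup hf hM), ?_, fun W => ?_⟩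
    · intro τ h
      cases τ <;> exact h
    · rw [isTI_geometry_iff, isTI_geometry_iff]
      refine ⟨?_, fun h v hv => h _ (Submodule.mem_map_of_mem hv)⟩
      rintro h _ ⟨v, hv, rfl⟩
      exact h v hv
  | hermitian σ invol ne_id B symm nondeg =>
    let B' : E →ₛₗ[σ] E →ₗ[F] F := (LinearMap.lcomp F F f).comp (B.comp f)
    have hB' : ∀ x y, B' x y = B (f x) (f y) := fun _ _ => rfl
    have symm' : B'.IsSymm := ⟨fun x y => by rw [hB', hB', symm.eq]⟩
    have hleft : ∀ x, (∀ y, B' x y = 0) → x = 0 := fun x hx => hzero x (hx x) hx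
    refine ⟨hermitian σ invol ne_id B' symm'
      ⟨hleft, fun y hy => hleft y fun x => symm'.isRefl _ _ (hy x)⟩, ?_, fun W => ?_⟩
    · intro τ h
      cases τ <;> exact h
    · rw [isTI_geometry_iff, isTI_geometry_iff]
      refine ⟨?_, fun h v hv w hw =>
        h _ (Submodule.mem_map_of_mem hv) _ (Submodule.mem_map_of_mem hw)⟩
      rintro h _ ⟨v, hv, rfl⟩ _ ⟨w, hw, rfl⟩
      exact h v hv w hw
  | symplectic B alt nondeg =>
    let B' : E →ₗ[F] E →ₗ[F] F := B.compl₁₂ f f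
    have hB' : ∀ x y, B' x y = B (f x) (f y) := fun _ _ => rfl
    have alt' : B'.IsAlt := fun x => alt (f x)
    have hleft : ∀ x, (∀ y, B' x y = 0) → x = 0 := fun x hx => hzero x trivial hx
    refine ⟨symplectic B' alt'
      ⟨hleft, fun y hy => hleft y fun x => alt'.isRefl _ _ (hy x)⟩, ?_, fun W => ?_⟩
    · intro τ h
      cases τ <;> exact h
    · rw [isTI_geometry_iff, isTI_geometry_iff]
      refine ⟨?_, fun h v hv w hw =>
        h _ (Submodule.mem_map_of_mem hv) _ (Submodule.mem_map_of_mem hw)⟩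
      rintro h _ ⟨v, hv, rfl⟩ _ ⟨w, hw, rfl⟩
      exact h v hv w hw

lemma ambientDim_add (τ : PolarType) (r k : ℕ) :
    τ.ambientDim (r + k) = τ.ambientDim r + 2 * k := by
  cases τ <;> simp only [PolarType.ambientDim] <;> omega

/-- The members of an EKR set that contain a given totally isotropic subspace form an EKR set of
the residue. -/
lemma ncard_le_maxEKR [Finite F] {P : PolarForm F V} {τ : PolarType} {d r k t : ℕ}
    (hP : P.IsPolarSpace τ d) (hd : d = r + k) {Y : Set (Submodule F V)} (hY : P.IsEKR d t Y)
    {T : Submodule F V} (hT : P.geometry.IsTI T) (hTdim : finrank F T = k) :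
    {y ∈ Y | T ≤ y}.ncard ≤ maxEKR F τ r t := by
  have := finite_submodule F V
  have hrank := hP.2.2.geometry
  obtain ⟨Q, hQ⟩ := Submodule.exists_isCompl T
  obtain ⟨M, hMdef⟩ : ∃ M : Submodule F V, M = Q ⊓ P.geometry.perp T := ⟨_, rfl⟩
  have hTM : T ⊓ M = ⊥ :=
    eq_bot_iff.2 (hMdef ▸ (inf_le_inf_left T inf_le_left).trans hQ.inf_eq_bot.le)
  have hsup : T ⊔ M = P.geometry.perp T := by
    rw [hMdef, ← sup_inf_assoc_of_le Q hT.le_perp, hQ.sup_eq_top, top_inf_eq]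
  have hMdim : finrank F M = τ.ambientDim r := by
    have h1 := Submodule.finrank_sup_add_finrank_inf_eq T M
    have h2 := hT.finrank_add_finrank_perp
    have h3 := hP.2.1
    rw [hTM, finrank_bot, hsup] at h1
    rw [hd, ambientDim_add] at h3
    omega
  let φ : (Fin (τ.ambientDim r) → F) ≃ₗ[F] M :=
    LinearEquiv.ofFinrankEq _ _ (by rw [finrank_fin_fun, hMdim])
  obtain ⟨f, hf, hfM⟩ : ∃ f : (Fin (τ.ambientDim r) → F) →ₗ[F] V,
      Function.Injective f ∧ LinearMap.range f = M := by
    refine ⟨M.subtype ∘ₗ φ.toLinearMap, M.injective_subtype.comp φ.injective, ?_⟩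
    rw [LinearMap.range_comp, LinearEquiv.range, Submodule.map_top, Submodule.range_subtype]
  obtain ⟨P', hkind, hTI⟩ := P.exists_residue hT hTM hsup hf hfM
  -- a subspace between `T` and its orthogonal is spanned by `T` and its intersection with `M`
  have hdecomp : ∀ A, T ≤ A → A ≤ P.geometry.perp T → T ⊔ M ⊓ A = A := fun A h1 h2 => by
    rw [← sup_inf_assoc_of_le M h1, hsup, inf_eq_right.2 h2]
  have hdim : ∀ A, T ≤ A → A ≤ P.geometry.perp T → finrank F (A.comap f) + k = finrank F A := by
    intro A h1 h2
    have h3 := Submodule.finrank_sup_add_finrank_inf_eq T (M ⊓ A)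
    rw [hdecomp A h1 h2, ← inf_assoc, hTM, bot_inf_eq, finrank_bot, hTdim] at h3
    rw [finrank_comap_of_injective hf, hfM, inf_comm]
    omega
  have hgenT : ∀ {y}, P.geometry.IsGen d y → T ≤ y → y ≤ P.geometry.perp T := fun hy hTy =>
    hy.1.le_perp.trans (PolarGeometry.perp_anti hTy)
  have hTI_dim : ∀ W, P'.geometry.IsTI W → finrank F W ≤ r := by
    intro W hW
    have hWM : W.map f ≤ M := hfM ▸ LinearMap.map_le_range
    have h1 := hrank.le (hT.sup ((hTI W).1 hW)
      (PolarGeometry.le_perp_comm.1 (hWM.trans (hsup ▸ le_sup_right))))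
    have h2 := Submodule.finrank_sup_add_finrank_inf_eq T (W.map f)
    have h3 : T ⊓ W.map f = ⊥ := eq_bot_iff.2 (hTM ▸ inf_le_inf_left T hWM)
    rw [h3, finrank_bot, finrank_map_of_injective hf] at h2
    omega
  have hgen : ∀ {y}, P.geometry.IsGen d y → T ≤ y →
      P'.IsGenerator (y.comap f) ∧ finrank F (y.comap f) = r := by
    intro y hy hTy
    have h1 : finrank F (y.comap f) = r := by
      have := hdim y hTy (hgenT hy hTy)
      rw [hy.2] at this
      omega
    have h2 : P'.geometry.IsTI (y.comap f) := (hTI _).2 (hy.1.mono (Submodule.map_comap_le f y))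
    refine ⟨(P'.maximal_isTI_geometry_iff).1 ⟨h2, fun W hW hle => ?_⟩, h1⟩
    exact (Submodule.eq_of_le_of_finrank_le hle ((hTI_dim W hW).trans h1.ge)).ge
  have hP' : P'.IsPolarSpace τ r := by
    refine ⟨hkind τ hP.1, finrank_fin_fun F, ?_⟩
    obtain ⟨y, hTy, hy⟩ := hrank.exists_gen hT
    exact ⟨_, hgen hy hTy⟩
  have hYgen : ∀ y ∈ Y, P.geometry.IsGen d y := fun y hy => (isGenerator_iff hP.2.2).1 (hY.1 y hy)
  have hinj : Set.InjOn (fun y : Submodule F V => y.comap f) {y ∈ Y | T ≤ y} := by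
    rintro y ⟨hy, hTy⟩ z ⟨hz, hTz⟩ h
    have h' := congrArg (Submodule.map f) h
    simp only [Submodule.map_comap_eq, hfM] at h'
    rw [← hdecomp y hTy (hgenT (hYgen y hy) hTy), h', hdecomp z hTz (hgenT (hYgen z hz) hTz)]
  have hfin := finite_submodule F (Fin (τ.ambientDim r) → F)
  refine le_csSup ⟨Nat.card (Submodule F (Fin (τ.ambientDim r) → F)), ?_⟩
    ⟨P', (fun y : Submodule F V => y.comap f) '' {y ∈ Y | T ≤ y}, hP', ⟨?_, ?_⟩, ?_⟩
  · rintro n ⟨-, Z, -, -, rfl⟩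
    rw [← Set.ncard_univ]
    exact Set.ncard_le_ncard (Set.subset_univ _)
  · rintro _ ⟨y, ⟨hy, hTy⟩, rfl⟩
    exact (hgen (hYgen y hy) hTy).1
  · rintro _ ⟨y, ⟨hy, hTy⟩, rfl⟩ _ ⟨z, ⟨hz, hTz⟩, rfl⟩
    have h1 := hdim (y ⊓ z) (le_inf hTy hTz) (inf_le_left.trans (hgenT (hYgen y hy) hTy))
    have h2 := hY.2 y hy z hz
    show (r : ℤ) - finrank F ↥((y ⊓ z).comap f) ≤ t
    omega
  · exact hinj.ncard_image.symm

/-- The members of an EKR set that meet a subspace `S` of dimension `n` in dimension at least `l`,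
counted by the `l`-spaces of `S`. -/
lemma ncard_inf_ge_le [Finite F] {P : PolarForm F V} {τ : PolarType} {d r l n k t : ℕ}
    (hP : P.IsPolarSpace τ d) (hd : d = r + l) {Y : Set (Submodule F V)} (hY : P.IsEKR d t Y)
    {S : Submodule F V} (hS : P.geometry.IsTI S) (hSdim : finrank F S = n) (hk : l + k = n) :
    ({y ∈ Y | l ≤ finrank F ↥(y ⊓ S)}.ncard : ℝ) ≤
      gauss (Nat.card F) n k * maxEKR F τ r t := by
  have := finite_submodule F V
  have hex : ∀ y : Submodule F V, l ≤ finrank F ↥(y ⊓ S) → ∃ T ≤ y ⊓ S, finrank F T = l :=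
    fun y hy => exists_le_finrank_eq _ hy
  choose! g hg hgdim using hex
  rw [mul_comm]
  refine le_trans (ncard_le_mul_of_fiber g
    (B := {T : Submodule F V | T ≤ S ∧ finrank F T = l}) ?_ (maxEKR F τ r t) ?_)
    (mul_le_mul_of_nonneg_left (ncard_le_codim_le_gauss hSdim hk) (Nat.cast_nonneg _))
  · rintro y ⟨-, hy⟩
    exact ⟨(hg y hy).trans inf_le_right, hgdim y hy⟩
  · rintro T ⟨hTS, hT⟩
    refine Nat.cast_le.2 (le_trans (Set.ncard_le_ncard ?_)
      (ncard_le_maxEKR hP hd hY (hS.mono hTS) hT))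
    rintro y ⟨⟨hyY, hy⟩, rfl⟩
    exact ⟨hyY, (hg y hy).trans inf_le_left⟩

lemma ncard_gens_le_omega [Finite F] {P : PolarForm F V} {d r k : ℕ} (hP : P.HasRank d)
    (hd : d = k + r) {Z : Submodule F V} (hZ : P.geometry.IsTI Z) (hZdim : finrank F Z = k) :
    {y | P.geometry.IsGen d y ∧ Z ≤ y}.ncard ≤ P.omega d r := by
  have := finite_submodule F V
  refine le_csSup ⟨Nat.card (Submodule F V), ?_⟩ ⟨Z, P.isTI_geometry_iff.1 hZ, by omega, ?_⟩
  · rintro n ⟨W, -, -, rfl⟩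
    rw [← Set.ncard_univ]
    exact Set.ncard_le_ncard (Set.subset_univ _)
  · simp only [isGenerator_iff hP]

end PolarForm

end ClassicalPolar

end

/-! ### Large maximal EKR sets -/

theorem mainTheorem3 {F V : Type*} [Field F] [Finite F] [AddCommGroup V] [Module F V]
    [FiniteDimensional F V] (P : ClassicalPolar.PolarForm F V) (τ : ClassicalPolar.PolarType)
    (d t : ℕ) (hP : P.IsPolarSpace τ d) (ht : 3 ≤ t) (htodd : Odd t) (hd : 2 * t - 1 ≤ d)
    (Y : Set (Submodule F V)) (hY : P.IsMaximalEKR d t Y)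
    (hcard : (Y.ncard : ℝ) > 2 * ClassicalPolar.b1Odd F τ d t + ClassicalPolar.b2Odd P d t
      + ClassicalPolar.b3Odd F τ d t) :
    ∃ U : Submodule F V, P.IsTotallyIsotropic U ∧ Module.finrank F U = d - 1 ∧
      Y = {G : Submodule F V | P.IsGenerator G ∧
        d - (t + 1) / 2 ≤ Module.finrank F ↥(G ⊓ U)} := by
  obtain ⟨m, rfl⟩ := htodd
  obtain ⟨e, rfl⟩ : ∃ e, d = 4 * m + 1 + e := ⟨d - (4 * m + 1), by omega⟩
  have hm : 1 ≤ m := by omega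
  have hfin := ClassicalPolar.finite_submodule F V
  have hrank := hP.2.2.geometry
  have hgeniff : ∀ {G}, P.IsGenerator G ↔ P.geometry.IsGen (4 * m + 1 + e) G :=
    ClassicalPolar.PolarForm.isGenerator_iff hP.2.2
  have hEKR := hY.prop
  have h : P.geometry.IsOddEKR m e Y := by
    refine ⟨hrank, fun y hy => hgeniff.1 (hEKR.1 y hy), fun y hy z hz => ?_⟩
    have := hEKR.2 y hy z hz
    push_cast at this
    omega
  have hb₁ : ∀ S, P.geometry.IsTI S → Module.finrank F S = e + m →
      ({y ∈ Y | e + 1 ≤ Module.finrank F ↥(y ⊓ S)}.ncard : ℝ) ≤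
        ClassicalPolar.b1Odd F τ (4 * m + 1 + e) (2 * m + 1) := by
    intro S hS hSdim
    have := ClassicalPolar.PolarForm.ncard_inf_ge_le (r := 4 * m) (l := e + 1) (k := m - 1) hP
      (by omega) hEKR hS hSdim (by omega)
    have e1 : 4 * m + 1 + e - (3 * (2 * m + 1) - 1) / 2 = e + m := by omega
    have e2 : (2 * m + 1 - 3) / 2 = m - 1 := by omega
    have e3 : 2 * (2 * m + 1) - 2 = 4 * m := by omega
    rwa [ClassicalPolar.b1Odd, e1, e2, e3]
  have hb₂ : ∀ U S T, P.geometry.IsTI U → Module.finrank F U = e + 4 * m → S ≤ U →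
      Module.finrank F S = e + m → T ≤ S → Module.finrank F T = e + 1 →
      ({y ∈ Y | Module.finrank F ↥(y ⊓ U) = e + 3 * m ∧ Module.finrank F ↥(y ⊓ S) = e ∧
        e + 2 ≤ Module.finrank F ↥(y ⊓ T) + m}.ncard : ℝ) ≤
        ClassicalPolar.b2Odd P (4 * m + 1 + e) (2 * m + 1) := by
    intro U S T hU hUdim hSU hS hTS hT
    have key := ClassicalPolar.PolarGeometry.ncard_inf_flag_le
      (N := P.omega (4 * m + 1 + e) (m + 1))
      (fun Z hZ hZdim => ClassicalPolar.PolarForm.ncard_gens_le_omega hP.2.2 (by omega) hZ hZdim)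
      hU hUdim hSU hS hTS hT
    have e0 : (2 * m + 1 + 1) / 2 = m + 1 := by omega
    have e1 : (2 * m + 1 - 3) / 2 = m - 1 := by omega
    have hpsi : ClassicalPolar.psiOdd F (4 * m + 1 + e) (2 * m + 1) =
        ∑ i ∈ Finset.Icc 1 (m - 1), ClassicalPolar.psi3 F (e + 4 * m) (e + m : ℕ) (e + 1 : ℕ)
          (e + 3 * m : ℕ) (e + 1 - m + i : ℤ) e := by
      rw [ClassicalPolar.psiOdd, e1]
      refine Finset.sum_congr rfl fun i _ => ?_
      congr 1 <;> push_cast <;> omega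
    rw [ClassicalPolar.b2Odd, e0, hpsi, ← Nat.cast_mul]
    refine Nat.cast_le.2 (le_trans (Set.ncard_le_ncard ?_) key)
    rintro y ⟨hy, hyU⟩
    exact ⟨h.gen y hy, hyU⟩
  have hb₃ : ∀ R S, P.geometry.IsGen (4 * m + 1 + e) R → S ≤ R → Module.finrank F S = e + m →
      ({y ∈ Y | Module.finrank F ↥(y ⊓ R) = e + 3 * m + 1 ∧
        Module.finrank F ↥(y ⊓ S) = e}.ncard : ℝ) ≤
        ClassicalPolar.b3Odd F τ (4 * m + 1 + e) (2 * m + 1) := by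
    intro R S hR hSR hS
    have key := ClassicalPolar.PolarGeometry.ncard_inf_gen_le hrank
      (ClassicalPolar.PolarForm.lineBound hP) hR hSR hS
    have hq : (0 : ℝ) < Nat.card F := Nat.cast_pos.2 Nat.card_pos
    have e1 : (2 * m + 1 - 1) / 2 = m := by omega
    have hpow : (Nat.card F : ℝ) ^ ((((2 * m + 1 : ℕ) : ℝ) - 1) / 2 * τ.eps + (m.choose 2 : ℕ)) =
        ((Nat.card F : ℝ) ^ τ.eps) ^ m * (Nat.card F : ℝ) ^ (m.choose 2) := by
      rw [Real.rpow_add hq, Real.rpow_natCast, ← Real.rpow_mul_natCast hq.le]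
      congr 2
      push_cast
      ring
    have hpsi : ClassicalPolar.psiBarOdd F (4 * m + 1 + e) (2 * m + 1) =
        ClassicalPolar.psi2 F (4 * m + 1 + e) (e + 3 * m + 1 : ℕ) (e + m : ℕ) e := by
      rw [ClassicalPolar.psiBarOdd]
      congr 1 <;> push_cast <;> omega
    rw [ClassicalPolar.b3Odd, e1, hpow, hpsi]
    refine le_trans (Nat.cast_le.2 (Set.ncard_le_ncard ?_)) key
    rintro y ⟨hy, hyR⟩
    exact ⟨h.gen y hy, hyR⟩
  -- the three bounds are nonnegative
  have hb₁0 : 0 ≤ ClassicalPolar.b1Odd F τ (4 * m + 1 + e) (2 * m + 1) := by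
    obtain ⟨G, hG, -⟩ := hP.2.2
    replace hG := hgeniff.1 hG
    obtain ⟨S, hSG, hS⟩ := ClassicalPolar.exists_le_finrank_eq G (k := e + m)
      (by rw [hG.2]; omega)
    exact (Nat.cast_nonneg _).trans (hb₁ S (hG.1.mono hSG) hS)
  have hb₂0 : 0 ≤ ClassicalPolar.b2Odd P (4 * m + 1 + e) (2 * m + 1) := by
    rw [ClassicalPolar.b2Odd]
    positivity
  have hb₃0 : 0 ≤ ClassicalPolar.b3Odd F τ (4 * m + 1 + e) (2 * m + 1) := by
    rw [ClassicalPolar.b3Odd]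
    positivity
  have hne : Y.Nonempty := by
    apply Set.nonempty_of_ncard_ne_zero
    intro h0
    rw [h0, Nat.cast_zero] at hcard
    linarith
  have hmem : ∀ z, P.geometry.IsGen (4 * m + 1 + e) z →
      (∀ y ∈ Y, e + 2 * m ≤ Module.finrank F ↥(z ⊓ y)) → z ∈ Y := by
    intro z hz hzY
    have hins : P.IsEKR (4 * m + 1 + e) (2 * m + 1) (insert z Y) := by
      have hgen : ∀ y ∈ insert z Y, P.IsGenerator y := by
        rintro y (rfl | hy)
        · exact hgeniff.2 hz
        · exact hEKR.1 y hy
      refine ⟨hgen, ?_⟩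
      rintro y (rfl | hy) x (rfl | hx)
      · rw [inf_idem, hz.2]
        push_cast
        omega
      · have := hzY x hx
        push_cast
        omega
      · have := hzY y hy
        rw [inf_comm] at this
        push_cast
        omega
      · exact hEKR.2 y hy x hx
    exact hY.le_of_ge hins (Set.subset_insert z Y) (Set.mem_insert z Y)
  have hpair : ∃ y ∈ Y, ∃ z ∈ Y, Module.finrank F ↥(y ⊓ z) = e + 2 * m := by
    obtain ⟨y, hy, z, hz, hyz⟩ := ClassicalPolar.PolarGeometry.exists_pair_of_maximal
      (t := 2 * m + 1) hrank (by omega) h.gen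
      (fun y hy z hz => by have := h.pair y hy z hz; omega)
      (fun z hz hzY => hmem z hz fun y hy => by have := hzY y hy; omega) hne
    exact ⟨y, hy, z, hz, by omega⟩
  obtain ⟨U, hU, hUdim, hYU⟩ :=
    h.exists_forall_inf_ge hm hb₁0 hb₂0 hb₃0 hb₁ hb₂ hb₃ hcard hpair
  have e1 : 4 * m + 1 + e - (2 * m + 1 + 1) / 2 = e + 3 * m := by omega
  refine ⟨U, P.isTI_geometry_iff.1 hU, by omega, ?_⟩
  rw [e1]
  refine Set.Subset.antisymm (fun y hy => ⟨hEKR.1 y hy, hYU y hy⟩) ?_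
  rintro z ⟨hz, hzU⟩
  refine hmem z (hgeniff.1 hz) fun y hy => ?_
  -- two subspaces of codimension at most `m` in `U` meet in codimension at most `2m`
  have h1 := ClassicalPolar.finrank_inf_add_le (inf_le_right : y ⊓ U ≤ U) z
  have h2 := hYU y hy
  have h3 := Submodule.finrank_mono (inf_le_inf_left z (inf_le_left : y ⊓ U ≤ y))
  omega
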